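/- Throughout, an ideal of a C*-algebra means a closed two-sided ideal. **Groups.** Let $G$ be a discrete group with identity $e$. For $M\subset G\setminus\{e\}$, a set $T\subset G$ is $M$-large if $m(G\setminus T)\subset T$ for all $m\in M$. A set $H\subset G$ is a Powers set for $F\subset G\setminus\{e\}$ if for every $N\in\mathbb N$ there are $h_1,\dots,h_N\in H$ and pairwise disjoint $T_1,\dots,T_N\subset G$ such that $T_j$ is $h_jFh_j^{-1}$-large for each $j$; it is a c-Powers set for $g\in G\setminus\{e\}$ if it is a Powers set for $\{aga^{-1}\mid a\in M\}$ for every finite non-empty $M\subset H$. $G$ is a *PH group* if every finite non-empty $F\subset G\setminus\{e\}$ can be written $F=\{f_1,\dots,f_n\}$ with subgroups $G_1\subset\cdots\subset G_n$ of $G$ such that $G_j$ is a c-Powers set for $f_j$. $G$ has *property $(P_{\rm com})$* if for every finite non-empty $F\subset G\setminus\{e\}$ there are $n$, $g_0\in G$ and $U,D_1,\dots,D_n\subset G$ such that $G\setminus U\subset D_1\cup\dots\cup D_n$, $gU\cap U=\emptyset$ for all $g\in F$, and $g_0^{-j}D_k\cap D_k=\emptyset$ for all $j\ge 1$ and all $k$.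 Let $\mathcal P$ be the class of groups that are PH groups or have property $(P_{\rm com})$. **Systems.** Let $X$ be a compact Hausdorff space and $\Sigma=(C(X),G,\alpha,\sigma)$ a twisted C*-dynamical system: $\alpha:G\to\mathrm{Aut}(C(X))$ and $\sigma:G\times G\to\mathcal U(C(X))$ satisfy $\alpha_g\circ\alpha_h=\mathrm{Ad}(\sigma(g,h))\circ\alpha_{gh}$, $\sigma(g,h)\sigma(gh,k)=\alpha_g(\sigma(h,k))\sigma(g,hk)$ and $\sigma(g,e)=\sigma(e,g)=1$. Let $G$ act on $X$ by the homeomorphisms with $\alpha_g(f)(x)=f(g^{-1}x)$. Let $C_r^*(\Sigma)$ be the reduced twisted crossed product, that is, with $C(X)$ acting on $\ell^2(X)$ by multiplication, the C*-algebra of operators on $\ell^2(G,\ell^2(X))$ generated by $(\pi(a)\xi)(h)=\alpha_{h^{-1}}(a)\xi(h)$, $a\in C(X)$, and $(\lambda(g)\xi)(h)=\sigma(h^{-1},g)\xi(g^{-1}h)$, $g\in G$; identify $a$ with $\pi(a)$. Let $E:C_r^*(\Sigma)\to C(X)$ be the canonical conditional expectation, with $E(a\lambda(g))=0$ for $g\ne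 e$. For a closed invariant $Y\subset X$ let $C_0(X\setminus Y)$ be the ideal of functions in $C(X)$ vanishing on $Y$, let $\langle C_0(X\setminus Y)\rangle$ be the ideal of $C_r^*(\Sigma)$ it generates, and let $(\alpha_Y,\sigma_Y)$ be the twisted action on $C(Y)\cong C(X)/C_0(X\setminus Y)$ induced by $(\alpha,\sigma)$. There is a canonical $*$-homomorphism $\kappa_Y:C_r^*(\Sigma)\to C_r^*(C(Y),G,\alpha_Y,\sigma_Y)$ with $a\mapsto a|_Y$, $\lambda(g)\mapsto\lambda_Y(g)$. $\Sigma$ is *exact* if $\ker\kappa_Y=\langle C_0(X\setminus Y)\rangle$ for every closed invariant $Y\subset X$ (equivalently, for every invariant ideal of $C(X)$). **Corollary.** Let $G\in\mathcal P$. Then $$\mu\longmapsto\int_X E(\cdot)\,d\mu$$ is a bijection from the set of $G$-invariant regular Borel probability measures on $X$ onto the set of tracial states of $C_r^*(\Sigma)$. Moreover, assume that $\Sigma$ is exact, and let $\mathcal Y$ be the set of minimal (non-empty) closed invariant subsets of $X$. Then $Y\mapsto\langle C_0(X\setminus Y)\rangle$ is a bijection from $\mathcal Y$ onto the set of maximal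 ideals of $C_r^*(\Sigma)$, and the simple quotients of $C_r^*(\Sigma)$ are exactly the algebras $C_r^*(C(Y),G,\alpha_Y,\sigma_Y)$, $Y\in\mathcal Y$: for each $Y\in\mathcal Y$ this algebra is simple and $\kappa_Y$ is surjective with kernel $\langle C_0(X\setminus Y)\rangle$; and for every surjective $*$-homomorphism $q:C_r^*(\Sigma)\to D$ onto a simple C*-algebra $D$ there are $Y\in\mathcal Y$ and a $*$-isomorphism $\psi:D\to C_r^*(C(Y),G,\alpha_Y,\sigma_Y)$ with $\psi\circ q=\kappa_Y$. -/

import Mathlib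

universe u v w

set_option linter.unusedSectionVars false

open scoped ComplexOrder

noncomputable section

namespace TwistedCrossed

/-! ### The class of groups -/

section Groups

variable {G : Type*} [Group G]

/-- `T` is `M`-large in `G`: `m (G ∖ T) ⊆ T` for all `m ∈ M`. -/
def IsLarge (M T : Set G) : Prop := ∀ m ∈ M, ∀ x ∉ T, m * x ∈ T

/-- `H` is a Powers set for `F`: for every `N` there are `h₁, …, h_N ∈ H` and pairwise disjoint
subsets `T₁, …, T_N` of `G` such that `T_j` is `h_j F h_j⁻¹`-large. -/
def IsPowersSet (H F : Set G) : Prop :=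
  ∀ N : ℕ, ∃ (h : Fin N → G) (T : Fin N → Set G),
    (∀ j, h j ∈ H) ∧ Pairwise (fun i j => Disjoint (T i) (T j)) ∧
      ∀ j, IsLarge {x | ∃ f ∈ F, x = h j * f * (h j)⁻¹} (T j)

/-- `H` is a c-Powers set for `g`: it is a Powers set for `{a g a⁻¹ | a ∈ M}`, for every finite
non-empty subset `M` of `H`. -/
def IsCPowersSet (H : Set G) (g : G) : Prop :=
  ∀ M : Set G, M.Finite → M.Nonempty → M ⊆ H → IsPowersSet H {x | ∃ a ∈ M, x = a * g * a⁻¹}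

variable (G)

/-- PH groups: every finite non-empty `F ⊆ G ∖ {e}` can be enumerated as `f₁, …, f_n` in such a
way that there is a chain of subgroups `K₁ ⊆ ⋯ ⊆ K_n` with `K_j` a c-Powers set for `f_j`. -/
def IsPH : Prop :=
  ∀ F : Finset G, F.Nonempty → (1 : G) ∉ F →
    ∃ (n : ℕ) (f : Fin n → G) (K : Fin n → Subgroup G),
      Function.Injective f ∧ Set.range f = (F : Set G) ∧ Monotone K ∧
        ∀ j, IsCPowersSet (K j : Set G) (f j)

/-- Property (P_com). -/
def HasPcom : Prop :=
  ∀ F : Finset G, F.Nonempty → (1 : G) ∉ F →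
    ∃ (n : ℕ) (g₀ : G) (U : Set G) (D : Fin n → Set G),
      Uᶜ ⊆ (⋃ k, D k) ∧
      (∀ g ∈ F, ∀ x ∈ U, g * x ∉ U) ∧
      (∀ j : ℕ, 1 ≤ j → ∀ k, ∀ x ∈ D k, (g₀ ^ j)⁻¹ * x ∉ D k)

/-- The class `𝒫`: PH groups and groups with property (P_com). -/
def InClassP : Prop := IsPH G ∨ HasPcom G

end Groups

/-! ### Closed ideals, simplicity, tracial states -/

section Algebras

variable {B : Type*} [Ring B] [TopologicalSpace B]

/-- The closed two-sided ideal generated by a set. -/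
def closedIdeal (s : Set B) : TwoSidedIdeal B :=
  sInf {I | IsClosed (I : Set B) ∧ s ⊆ (I : Set B)}

variable (B) in
/-- The maximal ideals: maximal elements among the proper closed two-sided ideals. -/
def maximalIdeals : Set (TwoSidedIdeal B) :=
  {I | Maximal (fun I : TwoSidedIdeal B => IsClosed (I : Set B) ∧ I ≠ ⊤) I}

variable (B) in
/-- Simplicity: nonzero, and without closed two-sided ideals other than `0` and the algebra. -/
def IsSimple : Prop :=
  Nontrivial B ∧ ∀ I : TwoSidedIdeal B, IsClosed (I : Set B) → I = ⊥ ∨ I = ⊤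

end Algebras

/-- Tracial states of a unital complex `*`-algebra: positive linear functionals `τ` with `τ 1 = 1`
and `τ (x y) = τ (y x)`. -/
def IsTracialState {B : Type*} [Ring B] [StarRing B] [Algebra ℂ B] (τ : B → ℂ) : Prop :=
  IsLinearMap ℂ τ ∧ (∀ x, 0 ≤ τ (star x * x)) ∧ τ 1 = 1 ∧ ∀ x y, τ (x * y) = τ (y * x)

/-! ### Weighted composition operators between `ℓ²`-spaces -/

section Operators

/-- The Hilbert space `ℓ²(ι)`. -/
abbrev L2 (ι : Type*) := lp (fun _ : ι => ℂ) 2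

variable {ι κ : Type*}

theorem wcomp_bound (w : κ → ℂ) (j : κ → ι) (hj : Function.Injective j) (C : ℝ) (hC : 0 ≤ C)
    (hw : ∀ k, ‖w k‖ ≤ C) (ξ : L2 ι) (s : Finset κ) :
    ∑ k ∈ s, ‖w k * ξ (j k)‖ ^ (2 : ENNReal).toReal ≤ (C * ‖ξ‖) ^ (2 : ENNReal).toReal := by
  have h2 : (0 : ℝ) < (2 : ENNReal).toReal := by simp
  calc ∑ k ∈ s, ‖w k * ξ (j k)‖ ^ (2 : ENNReal).toReal
      ≤ ∑ k ∈ s, C ^ (2 : ENNReal).toReal * ‖ξ (j k)‖ ^ (2 : ENNReal).toReal := by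
        refine Finset.sum_le_sum fun k _ => ?_
        rw [← Real.mul_rpow hC (norm_nonneg _), norm_mul]
        gcongr
        exact hw k
    _ = C ^ (2 : ENNReal).toReal *
          ∑ i ∈ s.map ⟨j, hj⟩, ‖ξ i‖ ^ (2 : ENNReal).toReal := by
        rw [Finset.sum_map, Finset.mul_sum]; rfl
    _ ≤ C ^ (2 : ENNReal).toReal * ‖ξ‖ ^ (2 : ENNReal).toReal := by
        gcongr
        exact lp.sum_rpow_le_norm_rpow h2 ξ _
    _ = _ := by rw [Real.mul_rpow hC (norm_nonneg _)]

/-- For `w` bounded by `C` and `j` injective, the bounded operator `ℓ²(ι) → ℓ²(κ)` given by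
`(W ξ)(k) = w k * ξ (j k)`. -/
def wcomp (w : κ → ℂ) (j : κ → ι) (hj : Function.Injective j) (C : ℝ) (hC : 0 ≤ C)
    (hw : ∀ k, ‖w k‖ ≤ C) : L2 ι →L[ℂ] L2 κ :=
  LinearMap.mkContinuous
    { toFun := fun ξ => ⟨fun k => w k * ξ (j k), memℓp_gen' (wcomp_bound w j hj C hC hw ξ)⟩
      map_add' := fun ξ η => by
        ext k
        exact mul_add _ _ _
      map_smul' := fun c ξ => by
        ext k
        exact mul_left_comm _ _ _ }
    C (fun ξ => lp.norm_le_of_forall_sum_le (by simp) (by positivity)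
      (wcomp_bound w j hj C hC hw ξ))

@[simp] theorem wcomp_apply (w : κ → ℂ) (j : κ → ι) (hj : Function.Injective j) (C : ℝ)
    (hC : 0 ≤ C) (hw : ∀ k, ‖w k‖ ≤ C) (ξ : L2 ι) (k : κ) :
    wcomp w j hj C hC hw ξ k = w k * ξ (j k) := rfl

open Classical in
/-- The canonical basis vector `δ_i` of `ℓ²(ι)`. -/
def delta (i : ι) : L2 ι := lp.single 2 i 1

open Classical in
theorem delta_apply (i k : ι) : delta i k = if k = i then 1 else 0 := by
  by_cases h : k = i
  · subst h; simp [delta]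
  · simp [delta, h]

theorem inner_delta_left (i : ι) (ξ : L2 ι) : inner ℂ (delta i) ξ = ξ i := by
  simp [delta, lp.inner_single_left]

end Operators

/-! ### Twisted actions -/

/-- A twisted action `(α, σ)` of the discrete group `G` on the unital C⋆-algebra `A`. -/
structure TwistedAction (G : Type*) [Group G] (A : Type*) [CStarAlgebra A] where
  α : G → (A ≃⋆ₐ[ℂ] A)
  σ : G → G → unitary A
  α_comp : ∀ g h a, α g (α h a) = (σ g h : A) * α (g * h) a * star (σ g h : A)
  cocycle : ∀ g h k, (σ g h : A) * (σ (g * h) k : A) = α g (σ h k : A) * (σ g (h * k) : A)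
  σ_one_right : ∀ g, σ g 1 = 1
  σ_one_left : ∀ g, σ 1 g = 1

namespace TwistedAction

variable {G : Type*} [Group G] {X : Type*} [TopologicalSpace X] [CompactSpace X]

section Commutative

variable (S : TwistedAction G C(X, ℂ))

theorem α_mul (g h : G) (f : C(X, ℂ)) : S.α g (S.α h f) = S.α (g * h) f := by
  rw [S.α_comp, mul_right_comm, Unitary.mul_star_self_of_mem (S.σ g h).2, one_mul]

theorem α_one (f : C(X, ℂ)) : S.α 1 f = f := by
  obtain ⟨f, rfl⟩ : ∃ f', S.α 1 f' = f := ⟨(S.α 1).symm f, (S.α 1).apply_symm_apply f⟩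
  rw [α_mul, one_mul]

theorem norm_α_apply_le (g : G) (f : C(X, ℂ)) (x : X) : ‖S.α g f x‖ ≤ ‖f‖ :=
  ((S.α g f).norm_coe_le_norm x).trans (StarAlgEquiv.norm_map (S.α g) f).le

theorem norm_σ_apply_le (g h : G) (x : X) : ‖(S.σ g h : C(X, ℂ)) x‖ ≤ 1 := by
  have h1 : star (S.σ g h : C(X, ℂ)) x * (S.σ g h : C(X, ℂ)) x = 1 := by
    have := Unitary.star_mul_self_of_mem (S.σ g h).2
    exact congrArg (fun f : C(X, ℂ) => f x) this
  have h2 := congrArg norm h1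
  rw [norm_mul, ContinuousMap.star_apply, norm_star, norm_one] at h2
  nlinarith [norm_nonneg ((S.σ g h : C(X, ℂ)) x)]

/-! ### The reduced crossed product -/

/-- `C(X)` acts faithfully on `ℓ²(X)` by multiplication, and the regular representation takes place
on `ℓ²(G, ℓ²(X)) = ℓ²(G × X)`: `(π(a) ξ)(h) = α_{h⁻¹}(a) ξ(h)`. -/
def regπ (a : C(X, ℂ)) : L2 (G × X) →L[ℂ] L2 (G × X) :=
  wcomp (fun p => S.α p.1⁻¹ a p.2) id Function.injective_id ‖a‖ (norm_nonneg a)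
    (fun p => S.norm_α_apply_le p.1⁻¹ a p.2)

theorem shift_injective (g : G) : Function.Injective (fun p : G × X => (g⁻¹ * p.1, p.2)) := by
  rintro ⟨h, x⟩ ⟨k, y⟩ hp
  simpa using hp

/-- `(λ(g) ξ)(h) = σ(h⁻¹, g) ξ(g⁻¹ h)`. -/
def regl (g : G) : L2 (G × X) →L[ℂ] L2 (G × X) :=
  wcomp (fun p => (S.σ p.1⁻¹ g : C(X, ℂ)) p.2) (fun p => (g⁻¹ * p.1, p.2)) (shift_injective g)
    1 zero_le_one (fun p => S.norm_σ_apply_le p.1⁻¹ g p.2)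

/-- The reduced twisted crossed product `C_r^*(C(X), G, α, σ)`: the C⋆-algebra of operators on
`ℓ²(G, ℓ²(X))` generated by `π(C(X))` and `λ(G)`. -/
def Cr : StarSubalgebra ℂ (L2 (G × X) →L[ℂ] L2 (G × X)) :=
  (StarAlgebra.adjoin ℂ (Set.range S.regπ ∪ Set.range S.regl)).topologicalClosure

/-- The copy of `a ∈ C(X)` in the reduced crossed product. -/
def inc (a : C(X, ℂ)) : S.Cr :=
  ⟨S.regπ a, StarSubalgebra.le_topologicalClosure _
    (StarAlgebra.subset_adjoin ℂ _ (Or.inl ⟨a, rfl⟩))⟩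

/-- The canonical unitary `λ(g)` in the reduced crossed product. -/
def lam (g : G) : S.Cr :=
  ⟨S.regl g, StarSubalgebra.le_topologicalClosure _
    (StarAlgebra.subset_adjoin ℂ _ (Or.inr ⟨g, rfl⟩))⟩

end Commutative

/-! ### The canonical conditional expectation -/

section Expectation

/-- Operators `(T ξ)(h, x) = w(h, x) ξ(g⁻¹ h, x)` with `w` bounded and continuous in `x`. They
include the generators of the reduced crossed product, and products and adjoints of such operators
have the same form. -/
def IsMonomial (T : L2 (G × X) →L[ℂ] L2 (G × X)) : Prop :=
  ∃ (w : G → X → ℂ) (g : G) (C : ℝ), (∀ h, Continuous (w h)) ∧ (∀ h x, ‖w h x‖ ≤ C) ∧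
    ∀ ξ h x, T ξ (h, x) = w h x * ξ (g⁻¹ * h, x)

theorem IsMonomial.mul {T T' : L2 (G × X) →L[ℂ] L2 (G × X)} (hT : IsMonomial T)
    (hT' : IsMonomial T') : IsMonomial (T * T') := by
  obtain ⟨w, g, C, hc, hb, hT⟩ := hT
  obtain ⟨w', g', C', hc', hb', hT'⟩ := hT'
  refine ⟨fun h x => w h x * w' (g⁻¹ * h) x, g * g', C * C',
    fun h => (hc h).mul (hc' _), fun h x => ?_, fun ξ h x => ?_⟩
  · rw [norm_mul]
    exact mul_le_mul (hb h x) (hb' _ x) (norm_nonneg _) ((norm_nonneg _).trans (hb h x))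
  · rw [mul_apply_eq_comp, hT, hT']
    simp [mul_assoc]

theorem IsMonomial.star {T : L2 (G × X) →L[ℂ] L2 (G × X)} (hT : IsMonomial T) :
    IsMonomial (star T) := by
  classical
  obtain ⟨w, g, C, hc, hb, hT⟩ := hT
  refine ⟨fun h x => starRingEnd ℂ (w (g * h) x), g⁻¹, C,
    fun h => Complex.continuous_conj.comp (hc _), fun h x => by simpa using hb (g * h) x,
    fun ξ h x => ?_⟩
  have hd : T (delta (h, x)) = w (g * h) x • delta (g * h, x) := by
    ext ⟨k, y⟩
    rw [hT, lp.coeFn_smul, Pi.smul_apply, smul_eq_mul, delta_apply, delta_apply]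
    by_cases hk : k = g * h ∧ y = x
    · obtain ⟨rfl, rfl⟩ := hk
      simp
    · rw [if_neg, if_neg]
      · simp
      · simpa using hk
      · simpa [inv_mul_eq_iff_eq_mul] using hk
  rw [← inner_delta_left, ContinuousLinearMap.star_eq_adjoint,
    ContinuousLinearMap.adjoint_inner_right, hd, inner_smul_left, inner_delta_left]
  simp

theorem isMonomial_one : IsMonomial (1 : L2 (G × X) →L[ℂ] L2 (G × X)) :=
  ⟨fun _ _ => 1, 1, 1, fun _ => continuous_const, fun _ _ => by simp, fun ξ h x => by simp⟩

variable (S : TwistedAction G C(X, ℂ))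

theorem adjoin_le_span {T : L2 (G × X) →L[ℂ] L2 (G × X)}
    (hT : T ∈ StarAlgebra.adjoin ℂ (Set.range S.regπ ∪ Set.range S.regl)) :
    T ∈ Submodule.span ℂ {T : L2 (G × X) →L[ℂ] L2 (G × X) | IsMonomial T} := by
  induction hT using StarAlgebra.adjoin_induction with
  | mem x hx =>
    refine Submodule.subset_span ?_
    rcases hx with ⟨a, rfl⟩ | ⟨g, rfl⟩
    · exact ⟨fun h x => S.α h⁻¹ a x, 1, ‖a‖, fun h => (S.α h⁻¹ a).continuous,
        fun h x => S.norm_α_apply_le _ a x, fun ξ h x => by simp [regπ]⟩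
    · exact ⟨fun h x => (S.σ h⁻¹ g : C(X, ℂ)) x, g, 1,
        fun h => (S.σ h⁻¹ g : C(X, ℂ)).continuous, fun h x => S.norm_σ_apply_le _ g x,
        fun ξ h x => by simp [regl]⟩
  | algebraMap r =>
    rw [Algebra.algebraMap_eq_smul_one]
    exact Submodule.smul_mem _ _ (Submodule.subset_span isMonomial_one)
  | add x y _ _ hx hy => exact Submodule.add_mem _ hx hy
  | mul x y _ _ hx hy =>
    have := Submodule.mul_mem_mul hx hy
    rw [Submodule.span_mul_span] at this
    refine Submodule.span_mono ?_ this
    rintro _ ⟨a, ha, b, hb, rfl⟩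
    exact IsMonomial.mul ha hb
  | star x hx' hx =>
    clear hx'
    induction hx using Submodule.span_induction with
    | mem x h => exact Submodule.subset_span (IsMonomial.star h)
    | zero => simp
    | add x y _ _ hx hy => rw [star_add]; exact Submodule.add_mem _ hx hy
    | smul c x _ hx => rw [star_smul]; exact Submodule.smul_mem _ _ hx

theorem norm_delta {ι : Type*} (i : ι) : ‖delta i‖ = 1 := by
  classical
  simp [delta, lp.norm_single]

theorem continuous_coeff (T : S.Cr) :
    Continuous fun x : X => (T : L2 (G × X) →L[ℂ] L2 (G × X)) (delta (1, x)) (1, x) := by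
  classical
  obtain ⟨T, hT⟩ := T
  have hspan : ∀ T ∈ Submodule.span ℂ {T : L2 (G × X) →L[ℂ] L2 (G × X) | IsMonomial T},
      Continuous fun x : X => T (delta (1, x)) (1, x) := by
    intro T hT
    induction hT using Submodule.span_induction with
    | mem T h =>
      obtain ⟨w, g, C, hc, -, h⟩ := h
      have : (fun x : X => T (delta (1, x)) (1, x)) =
          fun x => w 1 x * (if g = 1 then 1 else 0) := by
        funext x
        rw [h, delta_apply]
        simp
      rw [this]
      exact (hc 1).mul continuous_const
    | zero => simpa using continuous_const
    | add x y _ _ hx hy => exact (hx.add hy :)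
    | smul c x _ hx => exact (continuous_const.mul hx : Continuous fun x : X => c * _)
  refine continuous_of_uniform_approx_of_continuous fun u hu => ?_
  obtain ⟨ε, hε, hu⟩ := Metric.mem_uniformity_dist.1 hu
  have hT' : T ∈ closure ((StarAlgebra.adjoin ℂ (Set.range S.regπ ∪ Set.range S.regl) :
      StarSubalgebra ℂ _) : Set (L2 (G × X) →L[ℂ] L2 (G × X))) := hT
  obtain ⟨T', hT', hd⟩ := Metric.mem_closure_iff.1 hT' ε hε
  refine ⟨_, hspan T' (S.adjoin_le_span hT'), fun x => hu (lt_of_le_of_lt ?_ hd)⟩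
  have h1 : ‖((T - T') (delta (1, x)) : L2 (G × X)) (1, x)‖ ≤ ‖T - T'‖ := by
    refine (lp.norm_apply_le_norm (by simp) _ _).trans ?_
    simpa [norm_delta] using (T - T').le_opNorm (delta ((1 : G), x))
  rw [dist_eq_norm, dist_eq_norm]
  simpa using h1

/-- The canonical conditional expectation `E : C_r^*(C(X), G, α, σ) → C(X)`; the function `E(T)`
is the diagonal matrix coefficient of `T` at the identity of `G`,
`E(T)(x) = ⟨δ_{(e,x)}, T δ_{(e,x)}⟩ = (T δ_{(e,x)})(e, x)`. -/
def expect (T : S.Cr) : C(X, ℂ) :=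
  ⟨fun x => (T : L2 (G × X) →L[ℂ] L2 (G × X)) (delta (1, x)) (1, x), S.continuous_coeff T⟩

theorem expect_inc (a : C(X, ℂ)) : S.expect (S.inc a) = a := by
  ext x
  simp [expect, inc, regπ, delta_apply, S.α_one]

theorem expect_lam (g : G) (hg : g ≠ 1) : S.expect (S.lam g) = 0 := by
  ext x
  simp [expect, lam, regl, delta_apply, hg]

end Expectation

/-! ### The action on the space -/

section Space

variable [T2Space X]

theorem ext_eval {x y : X} (h : ∀ f : C(X, ℂ), f x = f y) : x = y :=
  (WeakDual.CharacterSpace.continuousMapEval_bijective (X := X) (𝕜 := ℂ)).1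
    (WeakDual.CharacterSpace.ext h)

variable (S : TwistedAction G C(X, ℂ))

open WeakDual in
/-- The map `x ↦ g·x` of `X` dual to `α_g`: evaluation at `g·x` is evaluation at `x` composed with
`α_g⁻¹`, that is, `α_g(f)(g·x) = f(x)`. -/
def actFun (g : G) (x : X) : X :=
  (CharacterSpace.homeoEval X ℂ).symm
    (CharacterSpace.compContinuousMap ((S.α g).symm : C(X, ℂ) →⋆ₐ[ℂ] C(X, ℂ))
      (CharacterSpace.homeoEval X ℂ x))

open WeakDual in
theorem continuous_actFun (g : G) : Continuous (S.actFun g) :=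
  (CharacterSpace.homeoEval X ℂ).symm.continuous.comp
    ((map_continuous _).comp (CharacterSpace.homeoEval X ℂ).continuous)

open WeakDual in
theorem apply_actFun (g : G) (f : C(X, ℂ)) (x : X) : f (S.actFun g x) = (S.α g).symm f x := by
  have h := (CharacterSpace.homeoEval X ℂ).apply_symm_apply
    (CharacterSpace.compContinuousMap ((S.α g).symm : C(X, ℂ) →⋆ₐ[ℂ] C(X, ℂ))
      (CharacterSpace.homeoEval X ℂ x))
  exact congrArg (fun χ : characterSpace ℂ C(X, ℂ) => χ f) h

theorem α_apply_actFun (g : G) (f : C(X, ℂ)) (x : X) : S.α g f (S.actFun g x) = f x := by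
  rw [apply_actFun, StarAlgEquiv.symm_apply_apply]

theorem actFun_mul (g h : G) (x : X) : S.actFun (g * h) x = S.actFun g (S.actFun h x) := by
  refine ext_eval fun f => ?_
  obtain ⟨f, rfl⟩ : ∃ f', S.α (g * h) f' = f :=
    ⟨(S.α (g * h)).symm f, (S.α (g * h)).apply_symm_apply f⟩
  rw [α_apply_actFun, ← S.α_mul, α_apply_actFun, α_apply_actFun]

theorem actFun_one (x : X) : S.actFun 1 x = x := by
  refine ext_eval fun f => ?_
  conv_lhs => rw [← S.α_one f]
  rw [α_apply_actFun]

/-- The action of `G` on `X` by homeomorphisms that induces `α`. -/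
def act (g : G) : X ≃ₜ X where
  toFun := S.actFun g
  invFun := S.actFun g⁻¹
  left_inv x := by rw [← actFun_mul, inv_mul_cancel, actFun_one]
  right_inv x := by rw [← actFun_mul, mul_inv_cancel, actFun_one]
  continuous_toFun := S.continuous_actFun g
  continuous_invFun := S.continuous_actFun g⁻¹

theorem act_inv_symm_apply (g : G) (x : X) : (S.act g⁻¹).symm x = S.act g x :=
  congrArg (fun k => S.actFun k x) (inv_inv g)

theorem α_apply (g : G) (f : C(X, ℂ)) (x : X) : S.α g f x = f ((S.act g).symm x) := by
  conv_lhs => rw [← (S.act g).apply_symm_apply x]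
  exact S.α_apply_actFun g f _

/-- The closed invariant subsets of `X`. -/
structure ClosedInvariant where
  carrier : Set X
  isClosed : IsClosed carrier
  invariant : ∀ g, ∀ x ∈ carrier, S.act g x ∈ carrier

namespace ClosedInvariant

variable {S} (Y : S.ClosedInvariant)

instance : CompactSpace Y.carrier := isCompact_iff_compactSpace.1 Y.isClosed.isCompact

theorem mem_iff (g : G) (x : X) : x ∈ Y.carrier ↔ S.act g x ∈ Y.carrier := by
  refine ⟨Y.invariant g x, fun h => ?_⟩
  have := Y.invariant g⁻¹ _ h
  rwa [show S.act g⁻¹ (S.act g x) = x from (S.act g).left_inv x] at this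

/-- The restricted homeomorphism `x ↦ g·x` of `Y`. -/
def actOn (g : G) : Y.carrier ≃ₜ Y.carrier := (S.act g).subtype (Y.mem_iff g)

/-- Restriction of functions, `C(X) → C(Y)`. -/
def res : C(X, ℂ) →⋆ₐ[ℂ] C(Y.carrier, ℂ) :=
  ContinuousMap.compStarAlgHom' ℂ ℂ ⟨Subtype.val, continuous_subtype_val⟩

theorem res_apply (f : C(X, ℂ)) (y : Y.carrier) : Y.res f y = f y := rfl

/-- The automorphism of `C(Y)` induced by `α_g`: `f ↦ (y ↦ f(g⁻¹·y))`. -/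
def αOn (g : G) : C(Y.carrier, ℂ) ≃⋆ₐ[ℂ] C(Y.carrier, ℂ) :=
  (Y.actOn g).symm.compStarAlgEquiv' ℂ ℂ

theorem αOn_apply (g : G) (f : C(Y.carrier, ℂ)) (y : Y.carrier) :
    Y.αOn g f y = f ((Y.actOn g).symm y) := rfl

theorem res_α (g : G) (f : C(X, ℂ)) : Y.res (S.α g f) = Y.αOn g (Y.res f) := by
  ext y
  rw [res_apply, S.α_apply, αOn_apply]
  rfl

/-- The twisted quotient action `(α_Y, σ_Y)` of `G` on `C(Y)`, with `σ_Y(g, h) = σ(g, h)|_Y`. -/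
def restrict : TwistedAction G C(Y.carrier, ℂ) where
  α := Y.αOn
  σ g h := ⟨Y.res (S.σ g h), Unitary.map_mem Y.res (S.σ g h).2⟩
  α_comp g h a := by
    have hu : Y.res (S.σ g h) * star (Y.res (S.σ g h)) = 1 :=
      Unitary.mul_star_self_of_mem (Unitary.map_mem Y.res (S.σ g h).2)
    rw [mul_right_comm, hu, one_mul]
    ext y
    rw [αOn_apply, αOn_apply, αOn_apply]
    congr 1
    rw [Homeomorph.symm_apply_eq, Homeomorph.symm_apply_eq]
    obtain ⟨z, rfl⟩ := (Y.actOn (g * h)).surjective y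
    rw [Homeomorph.symm_apply_apply]
    exact Subtype.ext (S.actFun_mul g h z)
  cocycle g h k := by
    have := congrArg Y.res (S.cocycle g h k)
    rwa [map_mul, map_mul, res_α] at this
  σ_one_right g := Subtype.ext (by simp [S.σ_one_right])
  σ_one_left g := Subtype.ext (by simp [S.σ_one_left])

/-! ### The canonical homomorphism onto the crossed product of a closed invariant subset -/

/-- The inclusion `G × Y → G × X`. -/
def incl (p : G × Y.carrier) : G × X := (p.1, p.2)

theorem incl_injective : Function.Injective Y.incl := by
  rintro ⟨g, x⟩ ⟨h, y⟩ h1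
  simp only [incl, Prod.mk.injEq] at h1
  exact Prod.ext h1.1 (Subtype.ext h1.2)

/-- Restriction of vectors, `R : ℓ²(G × X) → ℓ²(G × Y)`. -/
def R : L2 (G × X) →L[ℂ] L2 (G × Y.carrier) :=
  wcomp (fun _ => 1) Y.incl Y.incl_injective 1 zero_le_one (fun _ => by simp)

theorem R_apply (ξ : L2 (G × X)) (p : G × Y.carrier) : Y.R ξ p = ξ (Y.incl p) := by
  simp [R]

theorem adjoint_R_delta (p : G × Y.carrier) : Y.R.adjoint (delta p) = delta (Y.incl p) := by
  refine ext_inner_right ℂ fun ξ => ?_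
  rw [ContinuousLinearMap.adjoint_inner_left, inner_delta_left, inner_delta_left, R_apply]

theorem R_delta (p : G × Y.carrier) : Y.R (delta (Y.incl p)) = delta p := by
  classical
  ext q
  rw [R_apply, delta_apply, delta_apply]
  simp [Y.incl_injective.eq_iff]

theorem R_adjoint_R (η : L2 (G × Y.carrier)) : Y.R (Y.R.adjoint η) = η := by
  ext p
  rw [← inner_delta_left, ← ContinuousLinearMap.adjoint_inner_left, adjoint_R_delta,
    ContinuousLinearMap.adjoint_inner_right, R_delta, inner_delta_left]

open Classical in
theorem adjoint_R_R_apply (ξ : L2 (G × X)) (g : G) (x : X) :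
    Y.R.adjoint (Y.R ξ) (g, x) = if x ∈ Y.carrier then ξ (g, x) else 0 := by
  rw [← inner_delta_left, ContinuousLinearMap.adjoint_inner_right]
  by_cases hx : x ∈ Y.carrier
  · have : delta (g, x) = delta (Y.incl (g, ⟨x, hx⟩)) := rfl
    rw [this, R_delta, inner_delta_left, R_apply, if_pos hx]
    rfl
  · have : Y.R (delta (g, x)) = 0 := by
      ext p
      rw [R_apply, delta_apply, if_neg]
      · rfl
      · intro h
        have h2 : (p.2 : X) = x := congrArg Prod.snd h
        exact hx (h2 ▸ p.2.2)
    rw [this, inner_zero_left, if_neg hx]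

/-- Compression of operators to `ℓ²(G × Y)`. -/
def compress (T : L2 (G × X) →L[ℂ] L2 (G × X)) :
    L2 (G × Y.carrier) →L[ℂ] L2 (G × Y.carrier) :=
  Y.R ∘L T ∘L Y.R.adjoint

/-- Every element of the crossed product leaves `ℓ²(G × Y)` and its complement invariant. -/
theorem mem_commutant {T : L2 (G × X) →L[ℂ] L2 (G × X)} (hT : T ∈ S.Cr) (ξ : L2 (G × X)) :
    T (Y.R.adjoint (Y.R ξ)) = Y.R.adjoint (Y.R (T ξ)) := by
  classical
  set P : L2 (G × X) →L[ℂ] L2 (G × X) := Y.R.adjoint ∘L Y.R with hP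
  have hstar : star P = P := by
    rw [ContinuousLinearMap.star_eq_adjoint, hP, ContinuousLinearMap.adjoint_comp,
      ContinuousLinearMap.adjoint_adjoint]
  have hle : S.Cr ≤ StarSubalgebra.centralizer ℂ {P} := by
    refine StarSubalgebra.topologicalClosure_minimal (StarAlgebra.adjoin_le ?_)
      (Set.isClosed_centralizer _)
    intro T hT
    have key : P * T = T * P := by
      rcases hT with ⟨a, rfl⟩ | ⟨g, rfl⟩
      · ext ξ ⟨h, x⟩
        simp [hP, adjoint_R_R_apply, regπ]
      · ext ξ ⟨h, x⟩
        simp [hP, adjoint_R_R_apply, regl]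
    rw [SetLike.mem_coe, StarSubalgebra.mem_centralizer_iff]
    rintro z rfl
    rw [hstar]
    exact ⟨key, key⟩
  have h1 := ((StarSubalgebra.mem_centralizer_iff ℂ).1 (hle hT) P rfl).1
  exact (congrArg (fun A : L2 (G × X) →L[ℂ] L2 (G × X) => A ξ) h1).symm

theorem compress_mul {T T' : L2 (G × X) →L[ℂ] L2 (G × X)} (hT : T ∈ S.Cr) :
    Y.compress (T * T') = Y.compress T * Y.compress T' := by
  refine ContinuousLinearMap.ext fun η => ?_
  change Y.R (T (T' (Y.R.adjoint η))) =
    Y.R (T (Y.R.adjoint (Y.R (T' (Y.R.adjoint η)))))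
  rw [Y.mem_commutant hT, R_adjoint_R]

theorem compress_star (T : L2 (G × X) →L[ℂ] L2 (G × X)) :
    Y.compress (star T) = star (Y.compress T) := by
  simp only [compress, ContinuousLinearMap.star_eq_adjoint, ContinuousLinearMap.adjoint_comp,
    ContinuousLinearMap.adjoint_adjoint, ContinuousLinearMap.comp_assoc]

theorem compress_one : Y.compress 1 = 1 :=
  ContinuousLinearMap.ext fun η => Y.R_adjoint_R η

/-- If `R T = T' R` then `T'` is the compression of `T`. -/
theorem compress_eq {T : L2 (G × X) →L[ℂ] L2 (G × X)}
    {T' : L2 (G × Y.carrier) →L[ℂ] L2 (G × Y.carrier)} (h : ∀ ξ, Y.R (T ξ) = T' (Y.R ξ)) :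
    Y.compress T = T' := by
  refine ContinuousLinearMap.ext fun η => ?_
  change Y.R (T (Y.R.adjoint η)) = _
  rw [h, R_adjoint_R]

theorem compress_regπ (a : C(X, ℂ)) :
    Y.compress (S.regπ a) = Y.restrict.regπ (Y.res a) := by
  refine Y.compress_eq fun ξ => ?_
  ext p
  rw [R_apply]
  change S.α p.1⁻¹ a p.2 * ξ (Y.incl p) = Y.αOn p.1⁻¹ (Y.res a) p.2 * Y.R ξ p
  rw [R_apply, ← res_α, res_apply]

theorem compress_regl (g : G) : Y.compress (S.regl g) = Y.restrict.regl g := by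
  refine Y.compress_eq fun ξ => ?_
  ext p
  rw [R_apply]
  change (S.σ p.1⁻¹ g : C(X, ℂ)) p.2 * ξ _ =
    Y.res (S.σ p.1⁻¹ g : C(X, ℂ)) p.2 * Y.R ξ (g⁻¹ * p.1, p.2)
  rw [R_apply]
  rfl

theorem continuous_compress : Continuous Y.compress := by
  unfold compress
  fun_prop

theorem compress_add (T T' : L2 (G × X) →L[ℂ] L2 (G × X)) :
    Y.compress (T + T') = Y.compress T + Y.compress T' := by
  ext1 η
  simp [compress]

theorem compress_smul (c : ℂ) (T : L2 (G × X) →L[ℂ] L2 (G × X)) :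
    Y.compress (c • T) = c • Y.compress T := by
  ext1 η
  simp [compress]

theorem compress_mem {T : L2 (G × X) →L[ℂ] L2 (G × X)} (hT : T ∈ S.Cr) :
    Y.compress T ∈ Y.restrict.Cr := by
  have hsub : ∀ T ∈ StarAlgebra.adjoin ℂ (Set.range S.regπ ∪ Set.range S.regl),
      Y.compress T ∈ Y.restrict.Cr := by
    intro T hT
    induction hT using StarAlgebra.adjoin_induction with
    | mem T hT =>
      rcases hT with ⟨a, rfl⟩ | ⟨g, rfl⟩
      · rw [compress_regπ]; exact (Y.restrict.inc (Y.res a)).2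
      · rw [compress_regl]; exact (Y.restrict.lam g).2
    | algebraMap r =>
      rw [Algebra.algebraMap_eq_smul_one, compress_smul, compress_one]
      exact SMulMemClass.smul_mem r (one_mem _)
    | add T T' _ _ h h' => rw [compress_add]; exact add_mem h h'
    | mul T T' hT _ h h' =>
      rw [Y.compress_mul (StarSubalgebra.le_topologicalClosure _ hT)]; exact mul_mem h h'
    | star T _ h => rw [compress_star]; exact star_mem h
  have hclosed : IsClosed (Y.restrict.Cr : Set (L2 (G × Y.carrier) →L[ℂ] L2 (G × Y.carrier))) :=
    StarSubalgebra.isClosed_topologicalClosure _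
  exact closure_minimal hsub (hclosed.preimage Y.continuous_compress) hT

/-- The canonical `*`-homomorphism
`C_r^*(C(X), G, α, σ) → C_r^*(C(Y), G, α_Y, σ_Y)`, determined by `a ↦ a|_Y` for `a ∈ C(X)` and
`λ(g) ↦ λ_Y(g)`; it is the restriction of operators to the reducing subspace
`ℓ²(G × Y)` of `ℓ²(G × X)`. -/
def toQuotient : S.Cr →⋆ₐ[ℂ] Y.restrict.Cr where
  toFun T := ⟨Y.compress T, Y.compress_mem T.2⟩
  map_one' := Subtype.ext Y.compress_one
  map_mul' T T' := Subtype.ext (Y.compress_mul T.2)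
  map_zero' := Subtype.ext (by simp [compress])
  map_add' T T' := Subtype.ext (Y.compress_add T T')
  commutes' r := Subtype.ext (by
    change Y.compress (algebraMap ℂ _ r) = algebraMap ℂ _ r
    rw [Algebra.algebraMap_eq_smul_one, compress_smul, compress_one,
      Algebra.algebraMap_eq_smul_one])
  map_star' T := Subtype.ext (Y.compress_star T)

theorem toQuotient_inc (a : C(X, ℂ)) : Y.toQuotient (S.inc a) = Y.restrict.inc (Y.res a) :=
  Subtype.ext (Y.compress_regπ a)

theorem toQuotient_lam (g : G) : Y.toQuotient (S.lam g) = Y.restrict.lam g :=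
  Subtype.ext (Y.compress_regl g)

/-- The ideal `C₀(X ∖ Y)` of `C(X)`: the functions that vanish on `Y`. -/
def ideal : Ideal C(X, ℂ) := ContinuousMap.idealOfSet ℂ Y.carrierᶜ

/-- The induced ideal `⟨C₀(X ∖ Y)⟩` of the reduced crossed product. -/
def inducedIdeal : TwoSidedIdeal S.Cr := closedIdeal (S.inc '' (Y.ideal : Set C(X, ℂ)))

end ClosedInvariant

/-- The closed invariant ideals of `C(X)` are exactly the ideals `C₀(X ∖ Y)`, with `Y` a closed
invariant subset of `X`. -/
theorem closed_invariant_ideal_iff (J : Ideal C(X, ℂ)) :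
    (IsClosed (J : Set C(X, ℂ)) ∧ ∀ g, ∀ f ∈ J, S.α g f ∈ J) ↔
      ∃ Y : S.ClosedInvariant, Y.ideal = J := by
  constructor
  · rintro ⟨hJ, hinv⟩
    refine ⟨⟨(ContinuousMap.setOfIdeal J)ᶜ, (ContinuousMap.setOfIdeal_open J).isClosed_compl,
      fun g x hx => ?_⟩, ?_⟩
    · rw [ContinuousMap.setOfIdeal, compl_compl] at hx ⊢
      intro f hf
      have h1 := hx _ (hinv g⁻¹ f hf)
      rwa [S.α_apply, act_inv_symm_apply] at h1
    · rw [ClosedInvariant.ideal, compl_compl]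
      exact ContinuousMap.idealOfSet_ofIdeal_isClosed hJ
  · rintro ⟨Y, rfl⟩
    refine ⟨ContinuousMap.idealOfSet_closed ℂ _, fun g f hf => ?_⟩
    rw [ClosedInvariant.ideal, ContinuousMap.mem_idealOfSet] at hf ⊢
    intro x hx
    rw [S.α_apply]
    refine hf ?_
    rw [compl_compl] at hx ⊢
    exact Y.invariant g⁻¹ x hx

/-- Exactness of the system: for every invariant ideal `J = C₀(X ∖ Y)` of `C(X)`, the kernel of the
canonical homomorphism onto the reduced crossed product of the quotient system on `C(X)/J = C(Y)`
is the ideal generated by `J`. -/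
def IsExact : Prop :=
  ∀ Y : S.ClosedInvariant, ∀ T : S.Cr, Y.toQuotient T = 0 ↔ T ∈ Y.inducedIdeal

/-- The minimal closed invariant subsets of `X` (minimal among the non-empty ones). -/
def minimalSets : Set S.ClosedInvariant :=
  {Y | Y.carrier.Nonempty ∧
    ∀ Z : S.ClosedInvariant, Z.carrier.Nonempty → Z.carrier ⊆ Y.carrier → Z.carrier = Y.carrier}

/-- The invariant regular Borel probability measures on `X`. -/
def invariantMeasures [MeasurableSpace X] : Set (MeasureTheory.Measure X) :=
  {μ | MeasureTheory.IsProbabilityMeasure μ ∧ μ.Regular ∧ ∀ g, μ.map (S.act g) = μ}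

end Space

end TwistedAction

end TwistedCrossed

end

/-! The engine is a Dixmier-type averaging property (`exists_averaging_lt`): if `E(x) = 0`, iterated
averages of conjugates of `x` by the unitaries `λ(h)` become arbitrarily small in norm. By density
it suffices to treat finite sums `∑ a_g λ(g)` without a term at `e`. If `x` is supported in `F` and
`T_j` is `h_j F h_j⁻¹`-large, then the conjugate of `x` by `λ(h_j)` is off-diagonal for the
projection onto `ℓ²(T_j × X)`. When the `T_j` overlap at most `n` times, a sum of `N` such
conjugates has norm of order `√(n N)` (`norm_sum_le_of_offDiagonal`), so their mean tends to zero.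
Property (P_com) supplies sets of bounded multiplicity for all of `F` at once. For PH groups the
elements of `F` are treated one after another along the chain of subgroups
(`exists_averaging_of_chain`).

Traces: a tracial state is constant under averaging, hence equals `τ ∘ E`. Riesz representation
turns its restriction to `C(X)` into a measure, and invariance under conjugation by `λ(g)` is
invariance of the measure.

Ideals: for a proper ideal `J`, the common zeros of `E(J)` form a closed invariant set. It is
non-empty: otherwise compactness gives `y ∈ J` with `E(y)` bounded below by some `δ > 0`, and
averaging puts an element of `J` within `δ` of a function that is still bounded below by `δ`, which
forces `1 ∈ J`. Choose a minimal `Y` inside the zero set. For `b ∈ J` the expectation of `κ_Y(b* b)`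
is `E(b* b)|_Y = 0`, so `κ_Y(b) = 0` because the expectation is faithful. Thus every proper ideal
lies in `ker κ_Y` for some minimal `Y` (`exists_minimal_toQuotient_eq_zero`). Since inclusions
between such kernels force equality of the minimal sets, maximality, simplicity and the
classification of simple quotients follow; exactness identifies `ker κ_Y` with the induced ideal. -/

noncomputable section

namespace TwistedCrossed

namespace TwistedAction

/-! ### Relations between the generators, and density of the finite sums `∑ a_g λ(g)`. -/

section Relations

variable {G : Type*} [Group G] {X : Type*} [TopologicalSpace X] [CompactSpace X]
variable (S : TwistedAction G C(X, ℂ))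

scoped instance : Ring S.Cr := inferInstance
scoped instance : StarRing S.Cr := inferInstance
scoped instance : Algebra ℂ S.Cr := inferInstance
scoped instance : NormedRing S.Cr := inferInstance
scoped instance : AddCommGroup S.Cr := inferInstance
scoped instance : NonUnitalNonAssocRing S.Cr := inferInstance
scoped instance : AddCommMonoid S.Cr := inferInstance
scoped instance : Module ℂ S.Cr := inferInstance
scoped instance : TopologicalSpace S.Cr := inferInstance

theorem regπ_apply (a : C(X, ℂ)) (ξ : L2 (G × X)) (h : G) (x : X) :
    S.regπ a ξ (h, x) = S.α h⁻¹ a x * ξ (h, x) := rfl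

theorem regl_apply (g : G) (ξ : L2 (G × X)) (h : G) (x : X) :
    S.regl g ξ (h, x) = (S.σ h⁻¹ g : C(X, ℂ)) x * ξ (g⁻¹ * h, x) := rfl

theorem star_σ_mul_σ (g h : G) (x : X) :
    star ((S.σ g h : C(X, ℂ)) x) * (S.σ g h : C(X, ℂ)) x = 1 :=
  congrArg (fun f : C(X, ℂ) => f x) (Unitary.star_mul_self_of_mem (S.σ g h).2)

theorem regl_delta (g h : G) (x : X) :
    S.regl g (delta (h, x)) = (S.σ (g * h)⁻¹ g : C(X, ℂ)) x • delta (g * h, x) := by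
  classical
  ext ⟨k, y⟩
  rw [regl_apply, lp.coeFn_smul, Pi.smul_apply, smul_eq_mul, delta_apply, delta_apply]
  by_cases hk : k = g * h ∧ y = x
  · obtain ⟨rfl, rfl⟩ := hk
    simp
  · rw [if_neg, if_neg]
    · simp
    · simpa using hk
    · simpa [inv_mul_eq_iff_eq_mul] using hk

theorem star_regl_apply (g : G) (ξ : L2 (G × X)) (h : G) (x : X) :
    (star (S.regl g)) ξ (h, x) = star ((S.σ (g * h)⁻¹ g : C(X, ℂ)) x) * ξ (g * h, x) := by
  rw [← inner_delta_left, ContinuousLinearMap.star_eq_adjoint,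
    ContinuousLinearMap.adjoint_inner_right, regl_delta, inner_smul_left, inner_delta_left]
  simp

theorem star_lam_mul_lam (g : G) : star (S.lam g) * S.lam g = 1 := by
  refine Subtype.ext (ContinuousLinearMap.ext fun ξ => ?_)
  ext ⟨h, x⟩
  change (star (S.regl g)) (S.regl g ξ) (h, x) = ξ (h, x)
  rw [star_regl_apply, regl_apply, ← mul_assoc, star_σ_mul_σ]
  simp

theorem lam_mul_star_lam (g : G) : S.lam g * star (S.lam g) = 1 := by
  refine Subtype.ext (ContinuousLinearMap.ext fun ξ => ?_)
  ext ⟨h, x⟩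
  change S.regl g (star (S.regl g) ξ) (h, x) = ξ (h, x)
  rw [regl_apply, star_regl_apply, ← mul_assoc, mul_inv_cancel_left,
    mul_comm ((S.σ h⁻¹ g : C(X, ℂ)) x), star_σ_mul_σ, one_mul]

theorem lam_mem_unitary (g : G) : S.lam g ∈ unitary S.Cr :=
  ⟨S.star_lam_mul_lam g, S.lam_mul_star_lam g⟩

theorem inc_mul (a b : C(X, ℂ)) : S.inc (a * b) = S.inc a * S.inc b := by
  refine Subtype.ext (ContinuousLinearMap.ext fun ξ => ?_)
  ext ⟨h, x⟩
  change S.regπ (a * b) ξ (h, x) = S.regπ a (S.regπ b ξ) (h, x)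
  simp [regπ_apply, mul_assoc]

theorem inc_add (a b : C(X, ℂ)) : S.inc (a + b) = S.inc a + S.inc b := by
  refine Subtype.ext (ContinuousLinearMap.ext fun ξ => ?_)
  ext ⟨h, x⟩
  change S.regπ (a + b) ξ (h, x) = S.regπ a ξ (h, x) + S.regπ b ξ (h, x)
  simp [regπ_apply, add_mul]

theorem inc_smul (c : ℂ) (a : C(X, ℂ)) : S.inc (c • a) = c • S.inc a := by
  refine Subtype.ext (ContinuousLinearMap.ext fun ξ => ?_)
  ext ⟨h, x⟩
  change S.regπ (c • a) ξ (h, x) = c * S.regπ a ξ (h, x)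
  simp [regπ_apply, mul_assoc]

theorem inc_one : S.inc 1 = 1 := by
  refine Subtype.ext (ContinuousLinearMap.ext fun ξ => ?_)
  ext ⟨h, x⟩
  change S.regπ 1 ξ (h, x) = ξ (h, x)
  simp [regπ_apply]

theorem inc_star (a : C(X, ℂ)) : S.inc (star a) = star (S.inc a) := by
  refine Subtype.ext (ContinuousLinearMap.ext fun ξ => ?_)
  ext ⟨h, x⟩
  change S.regπ (star a) ξ (h, x) = (star (S.regπ a)) ξ (h, x)
  have hd : S.regπ a (delta (h, x)) = S.α h⁻¹ a x • delta (h, x) := by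
    classical
    ext ⟨k, y⟩
    rw [regπ_apply, lp.coeFn_smul, Pi.smul_apply, smul_eq_mul, delta_apply]
    by_cases hk : (k, y) = (h, x)
    · simp only [Prod.mk.injEq] at hk
      obtain ⟨rfl, rfl⟩ := hk
      simp
    · simp [hk]
  rw [← inner_delta_left (h, x) ((star (S.regπ a)) ξ), ContinuousLinearMap.star_eq_adjoint,
    ContinuousLinearMap.adjoint_inner_right, hd, inner_smul_left, inner_delta_left, regπ_apply,
    map_star]
  rfl

/-- The embedding of `C(X)` as a `*`-homomorphism. -/
def incHom : C(X, ℂ) →⋆ₐ[ℂ] S.Cr where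
  toFun := S.inc
  map_one' := S.inc_one
  map_mul' := S.inc_mul
  map_zero' := by simpa using S.inc_smul 0 0
  map_add' := S.inc_add
  commutes' c := by
    rw [Algebra.algebraMap_eq_smul_one, inc_smul, inc_one, Algebra.algebraMap_eq_smul_one]
  map_star' := S.inc_star

@[simp] theorem incHom_apply (a : C(X, ℂ)) : S.incHom a = S.inc a := rfl

theorem lam_mul_inc (g : G) (a : C(X, ℂ)) : S.lam g * S.inc a = S.inc (S.α g a) * S.lam g := by
  refine Subtype.ext (ContinuousLinearMap.ext fun ξ => ?_)
  ext ⟨h, x⟩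
  change S.regl g (S.regπ a ξ) (h, x) = S.regπ (S.α g a) (S.regl g ξ) (h, x)
  simp only [regπ_apply, regl_apply, α_mul]
  rw [mul_inv_rev, inv_inv]
  ring

theorem lam_mul_inc_mul_star (g : G) (a : C(X, ℂ)) :
    S.lam g * S.inc a * star (S.lam g) = S.inc (S.α g a) := by
  rw [lam_mul_inc, mul_assoc, lam_mul_star_lam, mul_one]

theorem lam_mul_lam (g h : G) :
    S.lam g * S.lam h = S.inc (S.σ g h : C(X, ℂ)) * S.lam (g * h) := by
  refine Subtype.ext (ContinuousLinearMap.ext fun ξ => ?_)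
  ext ⟨k, x⟩
  change S.regl g (S.regl h ξ) (k, x) = S.regπ _ (S.regl (g * h) ξ) (k, x)
  -- In the fibre over `k` the relation is the cocycle identity for the triple `(k⁻¹, g, h)`.
  have := congrArg (fun f : C(X, ℂ) => f x) (S.cocycle k⁻¹ g h)
  simp only [ContinuousMap.mul_apply] at this
  simp only [regπ_apply, regl_apply]
  have h1 : (g⁻¹ * k)⁻¹ = k⁻¹ * g := by group
  have h2 : (g * h)⁻¹ * k = h⁻¹ * (g⁻¹ * k) := by group
  rw [h1, h2]
  linear_combination ξ (h⁻¹ * (g⁻¹ * k), x) * this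

theorem lam_one : S.lam 1 = 1 := by
  refine Subtype.ext (ContinuousLinearMap.ext fun ξ => ?_)
  ext ⟨k, x⟩
  change S.regl 1 ξ (k, x) = ξ (k, x)
  simp [regl_apply, S.σ_one_right]

/-- The finite sums `∑ a_g λ(g)`. -/
def finSum : (G →₀ C(X, ℂ)) →ₗ[ℂ] S.Cr :=
  Finsupp.lsum ℂ fun g =>
    LinearMap.mulRight ℂ (S.lam g) ∘ₗ (S.incHom.toAlgHom.toLinearMap)

theorem finSum_apply (c : G →₀ C(X, ℂ)) :
    S.finSum c = c.sum fun g a => S.inc a * S.lam g := rfl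

theorem finSum_single (g : G) (a : C(X, ℂ)) :
    S.finSum (Finsupp.single g a) = S.inc a * S.lam g := by
  rw [finSum_apply, Finsupp.sum_single_index]
  simp [← incHom_apply]

theorem inc_mul_finSum_mem (a : C(X, ℂ)) {x : S.Cr} (hx : x ∈ LinearMap.range S.finSum) :
    S.inc a * x ∈ LinearMap.range S.finSum := by
  obtain ⟨c, rfl⟩ := hx
  induction c using Finsupp.induction_linear with
  | zero => simp
  | add c d hc hd => rw [map_add, mul_add]; exact add_mem hc hd
  | single g b =>
    exact ⟨Finsupp.single g (a * b), by rw [finSum_single, finSum_single, inc_mul, mul_assoc]⟩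

theorem lam_mul_finSum_mem (g : G) {x : S.Cr} (hx : x ∈ LinearMap.range S.finSum) :
    S.lam g * x ∈ LinearMap.range S.finSum := by
  obtain ⟨c, rfl⟩ := hx
  induction c using Finsupp.induction_linear with
  | zero => simp
  | add c d hc hd => rw [map_add, mul_add]; exact add_mem hc hd
  | single h b =>
    rw [finSum_single, ← mul_assoc, lam_mul_inc, mul_assoc, lam_mul_lam]
    exact S.inc_mul_finSum_mem _ (S.inc_mul_finSum_mem _ ⟨Finsupp.single (g * h) 1, by
      rw [finSum_single, inc_one, one_mul]⟩)

/-- The right-hand side is a right inverse of the unitary `λ(g)`. This keeps the finite sums stable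
under adjoints. -/
theorem star_lam (g : G) :
    star (S.lam g) = S.lam g⁻¹ * S.inc (star (S.σ g g⁻¹ : C(X, ℂ))) := by
  have h : S.lam g * (S.lam g⁻¹ * S.inc (star (S.σ g g⁻¹ : C(X, ℂ)))) = 1 := by
    rw [← mul_assoc, lam_mul_lam, mul_inv_cancel, lam_one, mul_one, ← inc_mul,
      Unitary.mul_star_self_of_mem (S.σ g g⁻¹).2, inc_one]
  rw [← mul_one (star (S.lam g)), ← h, ← mul_assoc, star_lam_mul_lam, one_mul]

theorem mul_finSum_mem {x y : S.Cr} (hx : x ∈ LinearMap.range S.finSum)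
    (hy : y ∈ LinearMap.range S.finSum) : x * y ∈ LinearMap.range S.finSum := by
  obtain ⟨c, rfl⟩ := hx
  induction c using Finsupp.induction_linear with
  | zero => simp
  | add c d hc hd => rw [map_add, add_mul]; exact add_mem hc hd
  | single h b =>
    rw [finSum_single, mul_assoc]
    exact S.inc_mul_finSum_mem _ (S.lam_mul_finSum_mem _ hy)

theorem inc_mem_finSum (a : C(X, ℂ)) : S.inc a ∈ LinearMap.range S.finSum :=
  ⟨Finsupp.single 1 a, by rw [finSum_single, lam_one, mul_one]⟩

theorem lam_mem_finSum (g : G) : S.lam g ∈ LinearMap.range S.finSum :=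
  ⟨Finsupp.single g 1, by rw [finSum_single, inc_one, one_mul]⟩

theorem star_finSum_mem {x : S.Cr} (hx : x ∈ LinearMap.range S.finSum) :
    star x ∈ LinearMap.range S.finSum := by
  obtain ⟨c, rfl⟩ := hx
  induction c using Finsupp.induction_linear with
  | zero => simp
  | add c d hc hd => rw [map_add, star_add]; exact add_mem hc hd
  | single h b =>
    rw [finSum_single, star_mul, ← inc_star, star_lam]
    exact S.mul_finSum_mem (S.mul_finSum_mem (S.lam_mem_finSum _) (S.inc_mem_finSum _))
      (S.inc_mem_finSum _)

theorem exists_finSum_coe {T : L2 (G × X) →L[ℂ] L2 (G × X)}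
    (hT : T ∈ StarAlgebra.adjoin ℂ (Set.range S.regπ ∪ Set.range S.regl)) :
    ∃ x ∈ LinearMap.range S.finSum, (x : L2 (G × X) →L[ℂ] L2 (G × X)) = T := by
  induction hT using StarAlgebra.adjoin_induction with
  | mem T hT =>
    rcases hT with ⟨a, rfl⟩ | ⟨g, rfl⟩
    · exact ⟨_, S.inc_mem_finSum a, rfl⟩
    · exact ⟨_, S.lam_mem_finSum g, rfl⟩
  | algebraMap r =>
    exact ⟨r • S.inc 1, Submodule.smul_mem _ _ (S.inc_mem_finSum 1), by
      rw [inc_one, Algebra.algebraMap_eq_smul_one]; rfl⟩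
  | add T T' _ _ h h' =>
    obtain ⟨x, hx, rfl⟩ := h
    obtain ⟨y, hy, rfl⟩ := h'
    exact ⟨x + y, add_mem hx hy, rfl⟩
  | mul T T' _ _ h h' =>
    obtain ⟨x, hx, rfl⟩ := h
    obtain ⟨y, hy, rfl⟩ := h'
    exact ⟨x * y, S.mul_finSum_mem hx hy, rfl⟩
  | star T _ h =>
    obtain ⟨x, hx, rfl⟩ := h
    exact ⟨star x, S.star_finSum_mem hx, rfl⟩

theorem exists_finSum_dist_lt (x : S.Cr) {ε : ℝ} (hε : 0 < ε) :
    ∃ c : G →₀ C(X, ℂ), ‖x - S.finSum c‖ < ε := by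
  obtain ⟨T, hT, hd⟩ := Metric.mem_closure_iff.1
    (show (x : L2 (G × X) →L[ℂ] L2 (G × X)) ∈ closure ((StarAlgebra.adjoin ℂ
      (Set.range S.regπ ∪ Set.range S.regl) :
      StarSubalgebra ℂ _) : Set (L2 (G × X) →L[ℂ] L2 (G × X))) from x.2) ε hε
  obtain ⟨_, ⟨c, rfl⟩, rfl⟩ := S.exists_finSum_coe hT
  exact ⟨c, by rwa [dist_eq_norm] at hd⟩

theorem denseRange_finSum : DenseRange S.finSum := fun x =>
  Metric.mem_closure_iff.2 fun _ hε => by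
    obtain ⟨c, hc⟩ := S.exists_finSum_dist_lt x hε
    exact ⟨_, ⟨c, rfl⟩, by rwa [dist_eq_norm]⟩

scoped instance isClosed_Cr : IsClosed (S.Cr : Set (L2 (G × X) →L[ℂ] L2 (G × X))) :=
  StarSubalgebra.isClosed_topologicalClosure _

/-- A property that is closed under sums and limits and holds on all `a λ(g)` holds everywhere. -/
theorem Cr_induction {p : S.Cr → Prop} (hc : IsClosed {x | p x}) (h0 : p 0)
    (hadd : ∀ x y, p x → p y → p (x + y)) (hm : ∀ a g, p (S.inc a * S.lam g)) (x : S.Cr) : p x := by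
  refine S.denseRange_finSum.induction_on x hc fun c => ?_
  induction c using Finsupp.induction_linear with
  | zero => simpa using h0
  | add c d hc hd => rw [map_add]; exact hadd _ _ hc hd
  | single h b => rw [finSum_single]; exact hm _ _

end Relations

/-! ### Equivariance and faithfulness of the conditional expectation. -/

section ExpectationProperties

variable {G : Type*} [Group G] {X : Type*} [TopologicalSpace X] [CompactSpace X]
variable (S : TwistedAction G C(X, ℂ))

theorem expect_apply (T : S.Cr) (x : X) :
    S.expect T x = (T : L2 (G × X) →L[ℂ] L2 (G × X)) (delta (1, x)) (1, x) := rfl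

theorem expect_add (x y : S.Cr) : S.expect (x + y) = S.expect x + S.expect y := rfl

theorem expect_smul (c : ℂ) (x : S.Cr) : S.expect (c • x) = c • S.expect x := rfl

theorem expect_sub (x y : S.Cr) : S.expect (x - y) = S.expect x - S.expect y := rfl

theorem expect_zero : S.expect 0 = 0 := rfl

theorem norm_coeff_le (T : L2 (G × X) →L[ℂ] L2 (G × X)) (p q : G × X) :
    ‖T (delta p) q‖ ≤ ‖T‖ :=
  (lp.norm_apply_le_norm (by simp) _ _).trans (by simpa [norm_delta] using T.le_opNorm (delta p))

theorem norm_expect_le (x : S.Cr) : ‖S.expect x‖ ≤ ‖x‖ :=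
  (ContinuousMap.norm_le _ (norm_nonneg _)).2 fun _ => norm_coeff_le _ _ _

theorem continuous_expect : Continuous S.expect :=
  (LinearMap.mkContinuous (⟨⟨S.expect, S.expect_add⟩, S.expect_smul⟩ : S.Cr →ₗ[ℂ] C(X, ℂ)) 1
    fun x => by simpa using S.norm_expect_le x).continuous

theorem norm_inc_le (a : C(X, ℂ)) : ‖S.inc a‖ ≤ ‖a‖ := NonUnitalStarAlgHom.norm_apply_le S.incHom a

theorem inc_injective : Function.Injective S.inc := fun a b h => by
  rw [← S.expect_inc a, h, expect_inc]

/-- Since `σ` is unimodular, `λ(g)` carries the basis vectors over `e`, which are the ones `E` sees,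
to those over any `g`. -/
theorem delta_eq_lam (g : G) (x : X) :
    ∃ c : ℂ, c ≠ 0 ∧ S.regl g (delta (1, x)) = c • delta (g, x) := by
  refine ⟨_, ?_, by simpa using S.regl_delta g 1 x⟩
  intro h
  have := S.star_σ_mul_σ (g * 1)⁻¹ g x
  simp_all

theorem expect_inc_mul (a : C(X, ℂ)) (T : S.Cr) : S.expect (S.inc a * T) = a * S.expect T := by
  ext x
  change S.regπ a _ (1, x) = _
  rw [regπ_apply, inv_one, α_one]
  rfl

theorem expect_mul_inc (a : C(X, ℂ)) (T : S.Cr) : S.expect (T * S.inc a) = a * S.expect T := by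
  classical
  ext x
  have : S.regπ a (delta (1, x)) = a x • delta (1, x) := by
    ext ⟨k, y⟩
    rw [regπ_apply, lp.coeFn_smul, Pi.smul_apply, smul_eq_mul, delta_apply]
    by_cases hk : (k, y) = (1, x)
    · simp only [Prod.mk.injEq] at hk
      obtain ⟨rfl, rfl⟩ := hk
      simp [α_one]
    · simp [hk]
  change (T : L2 (G × X) →L[ℂ] L2 (G × X)) (S.regπ a (delta (1, x))) (1, x) = _
  rw [this, map_smul]
  rfl

theorem expect_lam_conj (g : G) (T : S.Cr) :
    S.expect (S.lam g * T * star (S.lam g)) = S.α g (S.expect T) := by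
  induction T using S.Cr_induction with
  | hc =>
    exact isClosed_eq (S.continuous_expect.comp (by fun_prop))
      ((AlgHomClass.toAlgHom (S.α g)).toLinearMap.mkContinuous 1 (fun x => by
        simpa using (StarAlgEquiv.norm_map (S.α g) x).le) |>.continuous.comp S.continuous_expect)
  | h0 => simp [expect_zero]
  | hadd x y hx hy => rw [mul_add, add_mul, expect_add, hx, hy, expect_add, map_add]
  | hm a h =>
    have h1 : S.lam g * (S.inc a * S.lam h) * star (S.lam g) =
        S.inc (S.α g a) * (S.lam g * S.lam h * star (S.lam g)) := by
      rw [← mul_assoc, lam_mul_inc]; simp only [mul_assoc]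
    rw [h1, expect_inc_mul, expect_inc_mul, map_mul]
    congr 1
    by_cases hh : h = 1
    · subst hh
      rw [lam_one, mul_one, lam_mul_star_lam, ← inc_one, expect_inc, map_one]
    -- Up to coefficients from `C(X)`, the conjugate of `λ(h)` is `λ(g h g⁻¹)`, and `g h g⁻¹ ≠ e`.
    · rw [expect_lam S h hh, map_zero, star_lam, ← mul_assoc, expect_mul_inc, lam_mul_lam, mul_assoc,
        expect_inc_mul, lam_mul_lam, expect_inc_mul, expect_lam _ _ (by simpa using hh)]
      simp

theorem expect_star_mul_self_apply (T : S.Cr) (x : X) :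
    S.expect (star T * T) x =
      ((‖(T : L2 (G × X) →L[ℂ] L2 (G × X)) (delta (1, x))‖ ^ 2 : ℝ) : ℂ) := by
  rw [expect_apply]
  change ContinuousLinearMap.adjoint (T : L2 (G × X) →L[ℂ] L2 (G × X))
    ((T : L2 (G × X) →L[ℂ] L2 (G × X)) (delta (1, x))) (1, x) = _
  rw [← inner_delta_left, ContinuousLinearMap.adjoint_inner_right, inner_self_eq_norm_sq_to_K]
  simp

theorem norm_expect_apply_le (T : S.Cr) (x : X) :
    ‖S.expect T x‖ ≤ ‖(T : L2 (G × X) →L[ℂ] L2 (G × X)) (delta (1, x))‖ :=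
  lp.norm_apply_le_norm (by simp) _ _

/-- The value of `E(T* T)` at `x` is `‖T δ_(e,x)‖²`. Equivariance of `E` gives the same vanishing
for `T λ(g)`, so `T` kills every basis vector. -/
theorem eq_zero_of_expect_star_mul_self {T : S.Cr} (h : S.expect (star T * T) = 0) : T = 0 := by
  have h2 : ∀ p : G × X, (T : L2 (G × X) →L[ℂ] L2 (G × X)) (delta p) = 0 := by
    rintro ⟨g, x⟩
    have h1 := S.expect_star_mul_self_apply (T * S.lam g) x
    have h3 : S.expect (star (T * S.lam g) * (T * S.lam g)) = 0 := by
      have : S.expect (S.lam g * (star (T * S.lam g) * (T * S.lam g)) * star (S.lam g)) = 0 := by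
        rw [← h]
        congr 1
        simp only [star_mul, mul_assoc, lam_mul_star_lam, mul_one]
        rw [← mul_assoc, lam_mul_star_lam, one_mul]
      rw [expect_lam_conj] at this
      exact (map_eq_zero_iff _ (S.α g).injective).1 this
    rw [h3, ContinuousMap.zero_apply] at h1
    obtain ⟨c, hc, hd⟩ := S.delta_eq_lam g x
    have h4 : (T : L2 (G × X) →L[ℂ] L2 (G × X)) (S.regl g (delta (1, x))) = 0 := by
      have h5 : ‖(T * S.lam g : S.Cr).1 (delta (1, x))‖ ^ 2 = 0 := by
        exact_mod_cast h1.symm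
      exact norm_eq_zero.1 (pow_eq_zero_iff two_ne_zero |>.1 h5)
    rw [hd, map_smul] at h4
    exact (smul_eq_zero.1 h4).resolve_left hc
  -- The coordinates of `T* ξ` are the inner products `⟨T δ_p, ξ⟩`.
  have h3 : star (T : L2 (G × X) →L[ℂ] L2 (G × X)) = 0 := by
    refine ContinuousLinearMap.ext fun ξ => ?_
    ext p
    rw [← inner_delta_left, ContinuousLinearMap.star_eq_adjoint,
      ContinuousLinearMap.adjoint_inner_right, h2]
    simp
  exact Subtype.ext (star_eq_zero.1 h3)

theorem expect_toQuotient [T2Space X] (Y : S.ClosedInvariant) (T : S.Cr) :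
    Y.restrict.expect (Y.toQuotient T) = Y.res (S.expect T) := by
  ext y
  change Y.R ((T : L2 (G × X) →L[ℂ] L2 (G × X)) (Y.R.adjoint (delta (1, y)))) (1, y) = _
  rw [Y.adjoint_R_delta, Y.R_apply]
  rfl

end ExpectationProperties

end TwistedAction

end TwistedCrossed

namespace TwistedCrossed

/-! ### Norm estimates for sums of off-diagonal operators on `ℓ²`. -/

section RowNorm

variable {ι : Type*}

theorem L2.norm_sq_eq (ξ : L2 ι) : ‖ξ‖ ^ 2 = ∑' i, ‖ξ i‖ ^ 2 := by
  have := lp.norm_rpow_eq_tsum (p := 2) (by simp) ξ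
  simpa using this

theorem L2.summable_norm_sq (ξ : L2 ι) : Summable fun i => ‖ξ i‖ ^ 2 := by
  have := (lp.memℓp ξ).summable (p := 2) (by simp)
  simpa using this

open Classical in
/-- The projection of `ℓ²(ι)` onto `ℓ²(T)`. -/
def indProj (T : Set ι) : L2 ι →L[ℂ] L2 ι :=
  wcomp (fun i => if i ∈ T then 1 else 0) id Function.injective_id 1 zero_le_one
    (fun i => by split_ifs <;> simp)

open Classical in
theorem indProj_apply (T : Set ι) (ξ : L2 ι) (i : ι) :
    indProj T ξ i = if i ∈ T then ξ i else 0 := by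
  simp [indProj]

theorem norm_indProj_le (T : Set ι) : ‖indProj T‖ ≤ 1 :=
by
  unfold indProj wcomp
  exact LinearMap.mkContinuous_norm_le _ zero_le_one _

theorem star_indProj (T : Set ι) : star (indProj T) = indProj T := by
  classical
  rw [ContinuousLinearMap.star_eq_adjoint, eq_comm, ContinuousLinearMap.eq_adjoint_iff]
  intro ξ η
  simp only [lp.inner_eq_tsum, indProj_apply]
  refine tsum_congr fun i => ?_
  split_ifs <;> simp

theorem indProj_add_compl (T : Set ι) : indProj T + indProj Tᶜ = 1 := by
  classical
  refine ContinuousLinearMap.ext fun ξ => ?_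
  ext i
  change indProj T ξ i + indProj Tᶜ ξ i = ξ i
  by_cases h : i ∈ T <;> simp [indProj_apply, h]

-- At each coordinate at most `n` summands survive, so Cauchy–Schwarz costs a factor `n` instead of
-- `N`.
open Classical in
theorem norm_sq_sum_indProj_le {N n : ℕ} (T : Fin N → Set ι)
    (hT : ∀ i, (Finset.univ.filter fun j => i ∈ T j).card ≤ n) (ξ : Fin N → L2 ι) :
    ‖∑ j, indProj (T j) (ξ j)‖ ^ 2 ≤ n * ∑ j, ‖ξ j‖ ^ 2 := by
  have hsum : Summable fun i => (n : ℝ) * ∑ j, ‖ξ j i‖ ^ 2 :=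
    (summable_sum fun j _ => L2.summable_norm_sq (ξ j)).mul_left _
  have hco : ∀ i, (∑ j, indProj (T j) (ξ j)) i = ∑ j, indProj (T j) (ξ j) i := fun i => by
    rw [lp.coeFn_sum, Finset.sum_apply]
  calc ‖∑ j, indProj (T j) (ξ j)‖ ^ 2 = ∑' i, ‖(∑ j, indProj (T j) (ξ j)) i‖ ^ 2 :=
        L2.norm_sq_eq _
    _ ≤ ∑' i, (n : ℝ) * ∑ j, ‖ξ j i‖ ^ 2 := by
        refine Summable.tsum_le_tsum (fun i => ?_) (L2.summable_norm_sq _) hsum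
        rw [hco]
        simp only [indProj_apply]
        rw [← Finset.sum_filter]
        calc ‖∑ j ∈ Finset.univ.filter (fun j => i ∈ T j), ξ j i‖ ^ 2
            ≤ (∑ j ∈ Finset.univ.filter (fun j => i ∈ T j), ‖ξ j i‖) ^ 2 := by
              gcongr; exact norm_sum_le _ _
          _ ≤ (Finset.univ.filter (fun j => i ∈ T j)).card *
                ∑ j ∈ Finset.univ.filter (fun j => i ∈ T j), ‖ξ j i‖ ^ 2 := sq_sum_le_card_mul_sum_sq
          _ ≤ n * ∑ j, ‖ξ j i‖ ^ 2 := by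
              gcongr
              · exact hT i
              · exact Finset.filter_subset _ _
    _ = n * ∑ j, ‖ξ j‖ ^ 2 := by
        rw [tsum_mul_left, Summable.tsum_finsetSum fun j _ => L2.summable_norm_sq (ξ j)]
        simp only [L2.norm_sq_eq]

open Classical in
theorem norm_sum_indProj_mul_le {N n : ℕ} (T : Fin N → Set ι)
    (hT : ∀ i, (Finset.univ.filter fun j => i ∈ T j).card ≤ n) (y : Fin N → L2 ι →L[ℂ] L2 ι)
    {c : ℝ} (hc : 0 ≤ c) (hy : ∀ j, ‖y j‖ ≤ c) :
    ‖∑ j, indProj (T j) * y j‖ ≤ √(n * N) * c := by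
  refine ContinuousLinearMap.opNorm_le_bound _ (by positivity) fun ξ => ?_
  have h1 : (∑ j, indProj (T j) * y j) ξ = ∑ j, indProj (T j) (y j ξ) := by
    rw [sum_apply]; rfl
  rw [h1]
  refine le_of_sq_le_sq ?_ (by positivity)
  calc _ ≤ n * ∑ j, ‖y j ξ‖ ^ 2 := norm_sq_sum_indProj_le T hT _
    _ ≤ n * ∑ _j : Fin N, (c * ‖ξ‖) ^ 2 := by
        gcongr with j
        exact (y j).le_of_opNorm_le (hy j) ξ
    _ = _ := by
        rw [Finset.sum_const, Finset.card_univ, Fintype.card_fin, nsmul_eq_mul, mul_assoc (√_),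
          mul_pow (√_), Real.sq_sqrt (by positivity), mul_assoc]

open Classical in
/-- If each `y_j` is off-diagonal, `(1 - p_j) y_j (1 - p_j) = 0`, for projections `p_j` onto
subsets of multiplicity at most `n`, then `∑ y_j` grows only like the square root of the number of
summands. -/
theorem norm_sum_le_of_offDiagonal {N n : ℕ} (T : Fin N → Set ι)
    (hT : ∀ i, (Finset.univ.filter fun j => i ∈ T j).card ≤ n) (y : Fin N → L2 ι →L[ℂ] L2 ι)
    (hd : ∀ j, indProj (T j)ᶜ * y j * indProj (T j)ᶜ = 0)
    {c : ℝ} (hc : 0 ≤ c) (hy : ∀ j, ‖y j‖ ≤ c) :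
    ‖∑ j, y j‖ ≤ 2 * √(n * N) * c := by
  -- With `p` the projection, `y = p y + (1 - p) y p` because the corner `(1 - p) y (1 - p)`
  -- vanishes. The second term is the adjoint of `p y* (1 - p)`, so both terms have the shape
  -- bounded above.
  have h1 : ∀ j, y j = indProj (T j) * y j + star (indProj (T j) * (star (y j) * indProj (T j)ᶜ)) := by
    intro j
    rw [star_mul, star_mul, star_star, star_indProj, star_indProj]
    calc y j = (indProj (T j) + indProj (T j)ᶜ) * y j * (indProj (T j) + indProj (T j)ᶜ) := by
          rw [indProj_add_compl, one_mul, mul_one]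
      _ = indProj (T j) * y j * (indProj (T j) + indProj (T j)ᶜ) +
            indProj (T j)ᶜ * y j * indProj (T j) + indProj (T j)ᶜ * y j * indProj (T j)ᶜ := by
          noncomm_ring
      _ = _ := by rw [hd, indProj_add_compl, mul_one, add_zero]
  calc ‖∑ j, y j‖ = ‖∑ j, indProj (T j) * y j +
        star (∑ j, indProj (T j) * (star (y j) * indProj (T j)ᶜ))‖ := by
        rw [star_sum, ← Finset.sum_add_distrib]
        exact congrArg norm (Finset.sum_congr rfl fun j _ => h1 j)
    _ ≤ √(n * N) * c + √(n * N) * c := by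
        refine (norm_add_le _ _).trans (add_le_add (norm_sum_indProj_mul_le T hT y hc hy) ?_)
        refine (norm_star (∑ j, indProj (T j) * (star (y j) * indProj (T j)ᶜ))).trans_le ?_
        refine norm_sum_indProj_mul_le T hT _ hc fun j => ?_
        calc _ ≤ ‖star (y j)‖ * ‖indProj (T j)ᶜ‖ := norm_mul_le _ _
          _ ≤ c * 1 := by
            gcongr
            · exact (norm_star (y j)).trans_le (hy j)
            · exact norm_indProj_le _
          _ = c := mul_one c
    _ = _ := by ring

end RowNorm

/-! ### A common weakening of the Powers condition and of (P_com). -/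

section WeakPowers

variable {G : Type*} [Group G]

open Classical in
/-- The Powers condition with disjointness relaxed to multiplicity at most `n`. -/
def IsMultPowersSet (n : ℕ) (H F : Set G) : Prop :=
  ∀ N : ℕ, ∃ (h : Fin N → G) (T : Fin N → Set G),
    (∀ j, h j ∈ H) ∧ (∀ k, (Finset.univ.filter fun j => k ∈ T j).card ≤ n) ∧
      ∀ j, IsLarge {x | ∃ f ∈ F, x = h j * f * (h j)⁻¹} (T j)

theorem IsPowersSet.isMultPowersSet {H F : Set G} (h : IsPowersSet H F) :
    IsMultPowersSet 1 H F := by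
  intro N
  obtain ⟨h, T, hH, hT, hl⟩ := h N
  refine ⟨h, T, hH, fun k => ?_, hl⟩
  rw [Finset.card_le_one]
  intro i hi j hj
  by_contra hij
  exact Set.disjoint_left.1 (hT hij) (by simpa using hi) (by simpa using hj)

/-- Take `h_j = g₀⁻ʲ` and `T_j = g₀⁻ʲ (G ∖ U)`. Largeness is the translate of `g U ∩ U = ∅`. If `k ∈
T_j`, then `g₀ʲ k` lies in some `D_d`, and distinct `j` need distinct `d`, so `k` lies in at most
`n` of the `T_j`. -/
theorem HasPcom.exists_isMultPowersSet (hG : HasPcom G) (F : Finset G) (hF : F.Nonempty)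
    (h1 : (1 : G) ∉ F) : ∃ n, IsMultPowersSet n Set.univ (F : Set G) := by
  classical
  obtain ⟨n, g₀, U, D, hU, hFU, hD⟩ := hG F hF h1
  refine ⟨n, fun N => ⟨fun j => (g₀ ^ (j : ℕ))⁻¹, fun j => {k | g₀ ^ (j : ℕ) * k ∉ U},
    fun _ => trivial, fun k => ?_, ?_⟩⟩
  · have hex : ∀ j : Fin N, g₀ ^ (j : ℕ) * k ∉ U → ∃ d, g₀ ^ (j : ℕ) * k ∈ D d := fun j hj => by
      simpa using hU hj
    -- If there are no `D_k`, then `U = G` and all `T_j` are empty; `choose!` below needs a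
    -- non-empty index type.
    rcases isEmpty_or_nonempty (Fin n) with hn | hn
    · refine (Finset.card_eq_zero.2 ?_).trans_le (Nat.zero_le n)
      refine Finset.eq_empty_iff_forall_notMem.2 fun j hj => ?_
      exact hn.elim (hex j (by simpa using hj)).choose
    choose! d hd using hex
    calc _ ≤ (Finset.univ : Finset (Fin n)).card :=
          Finset.card_le_card_of_injOn d (by simp) ?_
      _ = n := by simp
    have key : ∀ i j : Fin N, i < j → ∀ c, g₀ ^ (i : ℕ) * k ∈ D c → g₀ ^ (j : ℕ) * k ∉ D c := by
      intro i j hij c hi hj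
      refine hD ((j : ℕ) - i) (Nat.sub_pos_of_lt hij) c _ hj ?_
      have hpow : g₀ ^ (j : ℕ) = g₀ ^ ((j : ℕ) - i) * g₀ ^ (i : ℕ) := by
        rw [← pow_add, Nat.sub_add_cancel hij.le]
      rwa [hpow, mul_assoc, inv_mul_cancel_left]
    intro i hi j hj hij
    simp only [Finset.coe_filter, Finset.mem_univ, true_and, Set.mem_ofPred_eq] at hi hj
    rcases lt_trichotomy i j with h | h | h
    · exact (key i j h _ (hd i hi) (hij ▸ hd j hj)).elim
    · exact h
    · exact (key j i h _ (hd j hj) (hij ▸ hd i hi)).elim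
  · rintro j _ ⟨f, hf, rfl⟩ k hk
    simp only [Set.mem_ofPred_eq, not_not] at hk ⊢
    have := hFU f hf _ hk
    rwa [inv_inv, mul_assoc, mul_assoc, mul_inv_cancel_left]

end WeakPowers

namespace TwistedAction

/-! ### Averaging elements of zero expectation to small norm. -/

section Averaging

variable {G : Type*} [Group G] {X : Type*} [TopologicalSpace X] [CompactSpace X]

/-- `T` is supported in `F ⊆ G`: it maps `ℓ²(S × X)` into `ℓ²(F S × X)` for all `S ⊆ G`. -/
def SupportedIn (F : Set G) (T : L2 (G × X) →L[ℂ] L2 (G × X)) : Prop :=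
  ∀ ξ k y, (∀ f ∈ F, ξ (f⁻¹ * k, y) = 0) → T ξ (k, y) = 0

theorem SupportedIn.mono {F F' : Set G} (h : F ⊆ F') {T : L2 (G × X) →L[ℂ] L2 (G × X)}
    (hT : SupportedIn F T) : SupportedIn F' T :=
  fun ξ k y hξ => hT ξ k y fun f hf => hξ f (h hf)

/-- For `k ∉ T` and `f ∈ F`, largeness forces `f⁻¹ k ∈ T`; a vector vanishing over `T` therefore
contributes nothing over `k`. -/
theorem SupportedIn.offDiagonal {F T : Set G} (hl : IsLarge F T)
    {y : L2 (G × X) →L[ℂ] L2 (G × X)} (hy : SupportedIn F y) :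
    indProj {p : G × X | p.1 ∈ T}ᶜ * y * indProj {p : G × X | p.1 ∈ T}ᶜ = 0 := by
  classical
  refine ContinuousLinearMap.ext fun ξ => ?_
  ext ⟨k, x⟩
  change indProj _ (y (indProj _ ξ)) (k, x) = 0
  rw [indProj_apply]
  split_ifs with hk
  · refine hy _ _ _ fun f hf => ?_
    rw [indProj_apply, if_neg]
    intro h
    have := hl f hf _ h
    rw [mul_inv_cancel_left] at this
    exact hk this
  · rfl

variable (S : TwistedAction G C(X, ℂ))

theorem supportedIn_inc_mul_lam (a : C(X, ℂ)) (g : G) :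
    SupportedIn {g} (S.inc a * S.lam g : S.Cr).1 := by
  intro ξ k y h
  change S.regπ a (S.regl g ξ) (k, y) = 0
  rw [regπ_apply, regl_apply, h g rfl, mul_zero, mul_zero]

/-- Conjugation by `λ(g)`. -/
def conj (g : G) : S.Cr →ₗ[ℂ] S.Cr :=
  LinearMap.mulRight ℂ (star (S.lam g)) ∘ₗ LinearMap.mulLeft ℂ (S.lam g)

theorem conj_apply (g : G) (x : S.Cr) : S.conj g x = S.lam g * x * star (S.lam g) := rfl

theorem norm_conj_apply (g : G) (x : S.Cr) : ‖S.conj g x‖ = ‖x‖ := by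
  rw [conj_apply, CStarRing.norm_mul_mem_unitary _ (Unitary.star_mem (S.lam_mem_unitary g)),
    CStarRing.norm_mem_unitary_mul _ (S.lam_mem_unitary g)]

theorem supportedIn_conj {F : Set G} (h : G) {x : S.Cr} (hx : SupportedIn F x.1) :
    SupportedIn {b | ∃ f ∈ F, b = h * f * h⁻¹} (S.conj h x).1 := by
  intro ξ k y hξ
  change S.regl h (x.1 (star (S.regl h) ξ)) (k, y) = 0
  rw [regl_apply, hx, mul_zero]
  intro f hf
  rw [star_regl_apply]
  have := hξ _ ⟨f, hf, rfl⟩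
  rw [show (h * f * h⁻¹)⁻¹ * k = h * (f⁻¹ * (h⁻¹ * k)) by group] at this
  rw [this, mul_zero]

/-- The average of the conjugations by `λ(h₀), …, λ(h_N)`. -/
def avg {N : ℕ} (h : Fin (N + 1) → G) : S.Cr →ₗ[ℂ] S.Cr :=
  ((N + 1 : ℂ)⁻¹) • ∑ j, S.conj (h j)

theorem avg_apply {N : ℕ} (h : Fin (N + 1) → G) (x : S.Cr) :
    S.avg h x = ((N + 1 : ℂ)⁻¹) • ∑ j, S.conj (h j) x := by
  simp [avg]

theorem norm_inv_natCast_succ (N : ℕ) : ‖((N + 1 : ℂ)⁻¹)‖ = ((N + 1 : ℝ))⁻¹ := by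
  rw [norm_inv]
  congr 1
  exact_mod_cast Complex.norm_natCast (N + 1)

theorem norm_avg_apply_le {N : ℕ} (h : Fin (N + 1) → G) (x : S.Cr) : ‖S.avg h x‖ ≤ ‖x‖ := by
  rw [avg_apply, norm_smul, norm_inv_natCast_succ, inv_mul_le_iff₀ (by positivity)]
  refine (norm_sum_le _ _).trans ?_
  simp only [norm_conj_apply, Finset.sum_const, Finset.card_univ, Fintype.card_fin,
    nsmul_eq_mul]
  push_cast
  exact le_rfl

theorem exists_norm_avg_lt {n : ℕ} {H F : Set G} (hp : IsMultPowersSet n H F) {x : S.Cr}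
    (hx : SupportedIn F x.1) {ε : ℝ} (hε : 0 < ε) :
    ∃ (N : ℕ) (h : Fin (N + 1) → G), (∀ j, h j ∈ H) ∧ ‖S.avg h x‖ < ε := by
  classical
  -- The mean of `N + 1` conjugates has norm at most `2 √(n / (N + 1)) ‖x‖`, which this `N` makes
  -- smaller than `ε`.
  obtain ⟨N, hN⟩ := exists_nat_gt (n * (2 * ‖x‖ / ε) ^ 2)
  obtain ⟨h, T, hH, hT, hl⟩ := hp (N + 1)
  refine ⟨N, h, hH, ?_⟩
  have h1 : ‖∑ j, (S.conj (h j) x).1‖ ≤ 2 * √(n * (N + 1 : ℕ)) * ‖x‖ :=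
    norm_sum_le_of_offDiagonal (fun j => {p : G × X | p.1 ∈ T j}) (fun p => hT p.1) _
      (fun j => SupportedIn.offDiagonal (hl j) (S.supportedIn_conj (h j) hx)) (norm_nonneg x)
      (fun j => (S.norm_conj_apply (h j) x).le)
  have h2 : ‖∑ j, S.conj (h j) x‖ ≤ 2 * √(n * (N + 1 : ℕ)) * ‖x‖ := by
    refine le_trans (le_of_eq ?_) h1
    rw [← AddSubmonoidClass.coe_finsetSum]
    rfl
  rw [avg_apply, norm_smul, norm_inv_natCast_succ, inv_mul_lt_iff₀ (by positivity)]
  refine h2.trans_lt (lt_of_pow_lt_pow_left₀ 2 (by positivity) ?_)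
  rw [mul_pow, mul_pow, Real.sq_sqrt (by positivity)]
  rw [div_pow, ← mul_div_assoc, div_lt_iff₀ (by positivity)] at hN
  push_cast
  nlinarith [sq_nonneg ε, mul_pos hε hε, (Nat.cast_nonneg N : (0 : ℝ) ≤ N),
    mul_lt_mul_of_pos_left hN (by positivity : (0 : ℝ) < N + 1)]

/-- Iterated averages of conjugations; `M` contains the products of the group elements used. -/
inductive IsAveraging : Set G → (S.Cr →ₗ[ℂ] S.Cr) → Prop
  | id : IsAveraging {1} LinearMap.id
  | comp {M : Set G} {φ : S.Cr →ₗ[ℂ] S.Cr} {N : ℕ} (h : Fin (N + 1) → G) :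
      IsAveraging M φ → IsAveraging {b | ∃ j, ∃ a ∈ M, b = h j * a} (S.avg h ∘ₗ φ)

variable {S}

namespace IsAveraging

variable {M : Set G} {φ : S.Cr →ₗ[ℂ] S.Cr}

theorem finite (h : S.IsAveraging M φ) : M.Finite := by
  induction h with
  | id => exact Set.finite_singleton 1
  | @comp M φ N h _ ih =>
    refine ((Set.finite_range h).image2 (· * ·) ih).subset ?_
    rintro _ ⟨j, a, ha, rfl⟩
    exact ⟨h j, ⟨j, rfl⟩, a, ha, rfl⟩

theorem nonempty (h : S.IsAveraging M φ) : M.Nonempty := by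
  induction h with
  | id => exact ⟨1, rfl⟩
  | @comp M φ N h _ ih =>
    obtain ⟨a, ha⟩ := ih
    exact ⟨h 0 * a, 0, a, ha, rfl⟩

theorem norm_apply_le (h : S.IsAveraging M φ) (x : S.Cr) : ‖φ x‖ ≤ ‖x‖ := by
  induction h with
  | id => exact le_rfl
  | comp h _ ih => exact (S.norm_avg_apply_le h _).trans ih

/-- A set that is stable under conjugations by the `λ(g)` and under arithmetic means is stable under
averaging. -/
theorem map_mem (h : S.IsAveraging M φ) {C : Set S.Cr}
    (hconj : ∀ g, ∀ x ∈ C, S.conj g x ∈ C)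
    (havg : ∀ (N : ℕ) (x : Fin (N + 1) → S.Cr), (∀ j, x j ∈ C) →
      ((N + 1 : ℂ)⁻¹) • ∑ j, x j ∈ C) {x : S.Cr} (hx : x ∈ C) : φ x ∈ C := by
  induction h with
  | id => exact hx
  | comp h _ ih =>
    rw [LinearMap.comp_apply, avg_apply]
    exact havg _ _ fun j => hconj _ _ ih

theorem supportedIn (h : S.IsAveraging M φ) {F : Set G} {x : S.Cr} (hx : SupportedIn F x.1) :
    SupportedIn {b | ∃ a ∈ M, ∃ f ∈ F, b = a * f * a⁻¹} (φ x).1 := by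
  induction h with
  | id =>
    refine hx.mono ?_
    exact fun f hf => ⟨1, rfl, f, hf, by simp⟩
  | @comp M φ N h _ ih =>
    intro ξ k y hξ
    rw [LinearMap.comp_apply, avg_apply]
    change (N + 1 : ℂ)⁻¹ * ((∑ j, S.conj (h j) (φ x) : S.Cr).1 ξ) (k, y) = 0
    have h1 : (∑ j, S.conj (h j) (φ x) : S.Cr).1 = ∑ j, (S.conj (h j) (φ x)).1 :=
      AddSubmonoidClass.coe_finsetSum _ _
    rw [h1, sum_apply, lp.coeFn_sum, Finset.sum_apply,
      Finset.sum_eq_zero, mul_zero]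
    intro j _
    refine S.supportedIn_conj (h j) ih ξ k y ?_
    rintro _ ⟨_, ⟨a, ha, f, hf, rfl⟩, rfl⟩
    exact hξ _ ⟨h j * a, ⟨j, a, ha, rfl⟩, f, hf, by group⟩

end IsAveraging

variable (S)

/-- Induction along the chain. The previous averaging `φ` uses products `M` lying in `K_m`, so
`φ(x_m)` is supported in the conjugates `a f_m a⁻¹` with `a ∈ M`; this is where a c-Powers set is
needed. The new conjugators lie in `K_m`, hence in all later subgroups, and since averages are
contractive the terms already small remain small. -/
theorem exists_averaging_of_chain {n : ℕ} (f : Fin n → G) (K : Fin n → Subgroup G)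
    (hK : Monotone K) (hc : ∀ j, IsCPowersSet (K j : Set G) (f j)) (x : Fin n → S.Cr)
    (hx : ∀ j, SupportedIn {f j} (x j).1) {ε : ℝ} (hε : 0 < ε) (m : ℕ) (hm : m ≤ n) :
    ∃ M φ, S.IsAveraging M φ ∧ (∀ j : Fin n, m ≤ j → M ⊆ K j) ∧
      ∀ j : Fin n, (j : ℕ) < m → ‖φ (x j)‖ < ε := by
  induction m with
  | zero =>
    refine ⟨_, _, .id, fun j _ => ?_, fun j hj => absurd hj (by simp)⟩
    rintro _ rfl
    exact one_mem (K j)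
  | succ m ih =>
    obtain ⟨M, φ, hφ, hM, hsmall⟩ := ih (by omega)
    let i : Fin n := ⟨m, hm⟩
    obtain ⟨N, h, hh, hlt⟩ := S.exists_norm_avg_lt
      (hc i M hφ.finite hφ.nonempty (hM i le_rfl)).isMultPowersSet
      ((hφ.supportedIn (hx i)).mono (by
        rintro _ ⟨a, ha, _, rfl, rfl⟩
        exact ⟨a, ha, rfl⟩)) hε
    refine ⟨_, _, .comp h hφ, fun j hj => ?_, fun j hj => ?_⟩
    · rintro _ ⟨l, a, ha, rfl⟩
      exact mul_mem (hK (show i ≤ j from Fin.le_def.2 (by change m ≤ _; omega)) (hh l))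
        (hM j (by omega) ha)
    · rcases Nat.lt_succ_iff_lt_or_eq.1 hj with h1 | h1
      · exact (S.norm_avg_apply_le h _).trans_lt (hsmall j h1)
      · have : j = i := Fin.ext h1
        rw [this]
        exact hlt

theorem exists_averaging_finSum (hG : InClassP G) (c : G →₀ C(X, ℂ)) (hc : c 1 = 0) {ε : ℝ}
    (hε : 0 < ε) : ∃ M φ, S.IsAveraging M φ ∧ ‖φ (S.finSum c)‖ < ε := by
  rcases c.support.eq_empty_or_nonempty with h0 | hne
  · rw [Finsupp.support_eq_empty] at h0
    exact ⟨_, _, .id, by simpa [h0] using hε⟩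
  have h1 : (1 : G) ∉ c.support := by simpa using hc
  rcases hG with hG | hG
  · obtain ⟨n, f, K, hf, hrange, hK, hcp⟩ := hG _ hne h1
    obtain ⟨M, φ, hφ, -, hsmall⟩ := S.exists_averaging_of_chain f K hK hcp
      (fun j => S.inc (c (f j)) * S.lam (f j)) (fun j => S.supportedIn_inc_mul_lam _ _)
      -- Then `n` terms of size at most `ε / (n + 1)` add up to strictly less than `ε`.
      (div_pos hε (Nat.cast_add_one_pos n)) n le_rfl
    refine ⟨M, φ, hφ, ?_⟩
    have hsum : S.finSum c = ∑ j, S.inc (c (f j)) * S.lam (f j) := by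
      classical
      have : c.support = Finset.univ.map ⟨f, hf⟩ := by
        ext g
        rw [← Finset.mem_coe, ← hrange]
        simp
      rw [finSum_apply, Finsupp.sum, this, Finset.sum_map]
      rfl
    rw [hsum, map_sum]
    calc _ ≤ ∑ j, ‖φ (S.inc (c (f j)) * S.lam (f j))‖ := norm_sum_le _ _
      _ ≤ ∑ _j : Fin n, ε / (n + 1) := Finset.sum_le_sum fun j _ => (hsmall j j.2).le
      _ < ε := by
        rw [Finset.sum_const, Finset.card_univ, Fintype.card_fin, nsmul_eq_mul, mul_div_assoc',
          div_lt_iff₀ (by positivity)]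
        nlinarith
  · obtain ⟨n, hn⟩ := hG.exists_isMultPowersSet _ hne h1
    have hsupp : SupportedIn (c.support : Set G) (S.finSum c).1 := by
      intro ξ k y hξ
      have h1 : (S.finSum c).1 = ∑ g ∈ c.support, (S.inc (c g) * S.lam g : S.Cr).1 :=
        AddSubmonoidClass.coe_finsetSum _ _
      rw [h1, sum_apply, lp.coeFn_sum, Finset.sum_apply]
      refine Finset.sum_eq_zero fun g hg => S.supportedIn_inc_mul_lam _ _ ξ k y ?_
      rintro _ rfl
      exact hξ _ hg
    obtain ⟨N, h, -, hlt⟩ := S.exists_norm_avg_lt hn hsupp hε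
    exact ⟨_, _, .comp h .id, hlt⟩

theorem expect_finSum (c : G →₀ C(X, ℂ)) : S.expect (S.finSum c) = c 1 := by
  classical
  induction c using Finsupp.induction_linear with
  | zero => simp [expect_zero]
  | add c d hc hd => rw [map_add, expect_add, hc, hd, Finsupp.add_apply]
  | single g b =>
    rw [finSum_single, expect_inc_mul, Finsupp.single_apply]
    split_ifs with h
    · rw [h, lam_one, ← inc_one, expect_inc, mul_one]
    · rw [expect_lam _ _ h, mul_zero]

/-- The Dixmier-type averaging property of crossed products by groups in `𝒫`. -/
theorem exists_averaging_lt (hG : InClassP G) {x : S.Cr} (hx : S.expect x = 0) {ε : ℝ}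
    (hε : 0 < ε) : ∃ M φ, S.IsAveraging M φ ∧ ‖φ x‖ < ε := by
  obtain ⟨c, hc⟩ := S.exists_finSum_dist_lt x (show 0 < ε / 3 by positivity)
  -- The coefficient at `e` is the expectation of the finite sum, which is close to `E(x) = 0`.
  have hc1 : ‖c 1‖ < ε / 3 := by
    rw [← S.expect_finSum c, ← norm_neg, ← zero_sub, ← hx, ← expect_sub]
    exact (S.norm_expect_le _).trans_lt hc
  obtain ⟨M, φ, hφ, hlt⟩ := S.exists_averaging_finSum hG (c - Finsupp.single 1 (c 1)) (by simp)
    (show 0 < ε / 3 by positivity)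
  refine ⟨M, φ, hφ, ?_⟩
  have h1 : x = (x - S.finSum c) + S.finSum (c - Finsupp.single 1 (c 1)) + S.inc (c 1) := by
    rw [map_sub, finSum_single, lam_one, mul_one]
    abel
  rw [h1, map_add, map_add]
  calc _ ≤ ‖φ (x - S.finSum c)‖ + ‖φ (S.finSum (c - Finsupp.single 1 (c 1)))‖ +
        ‖φ (S.inc (c 1))‖ := norm_add₃_le
    _ < ε / 3 + ε / 3 + ε / 3 := by
      gcongr
      · exact (hφ.norm_apply_le _).trans_lt hc
      · exact ((hφ.norm_apply_le _).trans (S.norm_inc_le _)).trans_lt hc1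
    _ = ε := by ring

end Averaging

end TwistedAction

end TwistedCrossed

namespace TwistedCrossed

/-! ### Continuity of traces and the Riesz representation of states on `C(X)`. -/

section PositiveFunctionals

/-- Positive linear functionals on a unital C⋆-algebra are continuous. -/
theorem IsTracialState.exists_norm_le {B : Type*} [CStarAlgebra B] {τ : B → ℂ}
    (hτ : IsTracialState τ) : ∃ C : ℝ, 0 ≤ C ∧ ∀ x, ‖τ x‖ ≤ C * ‖x‖ := by
  let _ := CStarAlgebra.spectralOrder B
  let _ := CStarAlgebra.spectralOrderedRing B
  obtain ⟨C, hC⟩ := (PositiveLinearMap.mk₀ hτ.1.mk' (fun x hx => by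
    obtain ⟨y, rfl⟩ := CStarAlgebra.nonneg_iff_eq_star_mul_self.1 hx
    exact hτ.2.1 y)).exists_norm_apply_le
  exact ⟨C, C.2, hC⟩

end PositiveFunctionals

section Measures

open MeasureTheory

variable {X : Type*} [TopologicalSpace X] [CompactSpace X] [T2Space X] [MeasurableSpace X]
  [BorelSpace X]

theorem integrable_continuousMap (μ : Measure X) [IsFiniteMeasure μ] (f : C(X, ℂ)) :
    Integrable f μ :=
  f.continuous.integrable_of_hasCompactSupport (HasCompactSupport.of_compactSpace f)

/-- The complexification of a real-valued continuous function. -/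
def complexify (f : C(X, ℝ)) : C(X, ℂ) := ⟨fun x => (f x : ℂ), by fun_prop⟩

theorem complexify_apply (f : C(X, ℝ)) (x : X) : complexify f x = f x := rfl

theorem ext_of_integral_continuousMap {μ ν : Measure X} [μ.Regular] [ν.Regular]
    (h : ∀ f : C(X, ℂ), ∫ x, f x ∂μ = ∫ x, f x ∂ν) : μ = ν := by
  refine Measure.ext_of_integral_eq_on_compactlySupported fun f => ?_
  have := h (complexify ⟨f, f.continuous⟩)
  simp only [complexify_apply, ContinuousMap.coe_mk, integral_complex_ofReal] at this
  exact_mod_cast this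

/-- The Riesz representation theorem for states on `C(X)`. -/
theorem exists_regular_measure_of_state (Λ : C(X, ℂ) →ₗ[ℂ] ℂ) (hpos : ∀ f, 0 ≤ Λ (star f * f))
    (h1 : Λ 1 = 1) : ∃ μ : Measure X, IsProbabilityMeasure μ ∧ μ.Regular ∧
      ∀ f : C(X, ℂ), Λ f = ∫ x, f x ∂μ := by
  have hnonneg : ∀ f : C(X, ℝ), (∀ x, 0 ≤ f x) → 0 ≤ Λ (complexify f) := by
    intro f hf
    -- A non-negative `f` is `g* g` with `g = √f`.
    have := hpos (complexify ⟨fun x => √(f x), by fun_prop⟩)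
    convert this using 2
    ext x
    simp only [complexify_apply, ContinuousMap.mul_apply, ContinuousMap.star_apply,
      ContinuousMap.coe_mk, RCLike.star_def, Complex.conj_ofReal]
    rw [← Complex.ofReal_mul, Real.mul_self_sqrt (hf x)]
  have hreal : ∀ f : C(X, ℝ), (Λ (complexify f)).im = 0 := by
    intro f
    -- Adding the constant `‖f‖` makes `f` non-negative and changes the value of `Λ` by a real
    -- number only, since `Λ 1 = 1`.
    have h2 := (Complex.nonneg_iff.1 (hnonneg (f + ContinuousMap.const X ‖f‖) fun x => by
      have := neg_le_of_abs_le ((Real.norm_eq_abs _).symm.trans_le (f.norm_coe_le_norm x))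
      simpa using by linarith)).2
    have h3 : complexify (f + ContinuousMap.const X ‖f‖) =
        complexify f + ((‖f‖ : ℝ) : ℂ) • (1 : C(X, ℂ)) := by
      ext x; simp [complexify_apply]
    rw [h3, map_add, map_smul, h1] at h2
    simpa using h2.symm
  let L : CompactlySupportedContinuousMap X ℝ →ₚ[ℝ] ℝ := PositiveLinearMap.mk₀
    { toFun := fun f => (Λ (complexify ⟨f, f.continuous⟩)).re
      map_add' := fun f g => by
        rw [← Complex.add_re, ← map_add]
        congr 2
        ext x
        simp [complexify_apply]
      map_smul' := fun c f => by
        have : complexify ⟨(c • f : CompactlySupportedContinuousMap X ℝ), (c • f).continuous⟩ =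
            (c : ℂ) • complexify ⟨f, f.continuous⟩ := by
          ext x
          simp [complexify_apply]
        rw [this, map_smul]
        simp }
    (fun f hf => (Complex.nonneg_iff.1 (hnonneg _ fun x => hf x)).1)
  have hL : ∀ f : C(X, ℝ), Λ (complexify f) = ∫ x, (f x : ℂ) ∂(RealRMK.rieszMeasure L) := by
    intro f
    have h2 := RealRMK.integral_rieszMeasure L (CompactlySupportedContinuousMap.continuousMapEquiv f)
    rw [integral_complex_ofReal]
    refine Complex.ext ?_ ?_
    · rw [Complex.ofReal_re]
      exact h2.symm
    · rw [Complex.ofReal_im, hreal]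
  have hall : ∀ f : C(X, ℂ), Λ f = ∫ x, f x ∂(RealRMK.rieszMeasure L) := by
    intro f
    let u : C(X, ℝ) := ⟨fun x => (f x).re, by fun_prop⟩
    let v : C(X, ℝ) := ⟨fun x => (f x).im, by fun_prop⟩
    have hf : f = complexify u + Complex.I • complexify v := by
      ext x
      simp only [ContinuousMap.add_apply, ContinuousMap.smul_apply, complexify_apply, smul_eq_mul]
      rw [mul_comm]
      exact (Complex.re_add_im (f x)).symm
    have h2 : ∫ x, f x ∂(RealRMK.rieszMeasure L) =
        ∫ x, (complexify u x + Complex.I * complexify v x) ∂(RealRMK.rieszMeasure L) := by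
      refine integral_congr_ae (.of_forall fun x => ?_)
      exact congrArg (fun k : C(X, ℂ) => k x) hf
    rw [h2, integral_add (integrable_continuousMap _ _)
      ((integrable_continuousMap _ _).const_mul _), integral_const_mul]
    conv_lhs => rw [hf]
    rw [map_add, map_smul, hL, hL]
    rfl
  refine ⟨RealRMK.rieszMeasure L, ⟨?_⟩, inferInstance, hall⟩
  have h3 := hall 1
  rw [h1] at h3
  have h4 : (RealRMK.rieszMeasure L).real Set.univ = 1 := by
    simp only [ContinuousMap.one_apply, integral_const, Complex.real_smul, mul_one] at h3
    exact_mod_cast h3.symm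
  rwa [Measure.real, ENNReal.toReal_eq_one_iff] at h4

end Measures

namespace TwistedAction

open MeasureTheory

/-! ### Tracial states and invariant measures. -/

section Traces

variable {G : Type*} [Group G] {X : Type*} [TopologicalSpace X] [CompactSpace X]
  (S : TwistedAction G C(X, ℂ))

theorem IsAveraging.apply_trace {S : TwistedAction G C(X, ℂ)} {M : Set G}
    {φ : S.Cr →ₗ[ℂ] S.Cr} (h : S.IsAveraging M φ) {τ : S.Cr → ℂ} (hτ : IsTracialState τ)
    (x : S.Cr) : τ (φ x) = τ x := by
  refine h.map_mem (C := {y | τ y = τ x}) (fun g y hy => ?_) (fun N y hy => ?_) rfl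
  · change τ _ = _
    rw [conj_apply, hτ.2.2.2, ← mul_assoc, star_lam_mul_lam, one_mul]
    exact hy
  · have hs : τ (∑ j, y j) = ∑ j, τ (y j) := map_sum hτ.1.mk' y _
    change τ _ = τ x
    rw [hτ.1.map_smul, hs, Finset.sum_congr rfl fun j _ => hy j, Finset.sum_const,
      Finset.card_univ, Fintype.card_fin, nsmul_eq_mul, smul_eq_mul]
    push_cast
    rw [inv_mul_cancel_left₀ (by exact_mod_cast Nat.succ_ne_zero N)]

/-- Tracial states factor through the conditional expectation. -/
theorem trace_eq_trace_expect (hG : InClassP G) {τ : S.Cr → ℂ} (hτ : IsTracialState τ)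
    (x : S.Cr) : τ x = τ (S.inc (S.expect x)) := by
  obtain ⟨C, hC0, hC⟩ := hτ.exists_norm_le
  have h0 : S.expect (x - S.inc (S.expect x)) = 0 := by rw [expect_sub, expect_inc, sub_self]
  have h1 : τ (x - S.inc (S.expect x)) = 0 := by
    refine norm_le_zero_iff.1 (le_of_forall_pos_lt_add fun ε hε => ?_)
    -- The bound `C` of `τ` may be zero, hence `C + 1` in the denominator.
    obtain ⟨M, φ, hφ, hlt⟩ := S.exists_averaging_lt hG h0
      (show 0 < ε / (C + 1) by positivity)
    rw [← hφ.apply_trace hτ, zero_add]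
    refine (hC _).trans_lt ?_
    rw [lt_div_iff₀ (by positivity)] at hlt
    nlinarith [norm_nonneg (φ (x - S.inc (S.expect x)))]
  have h2 := hτ.1.mk'.map_sub x (S.inc (S.expect x))
  exact sub_eq_zero.1 (h2.symm.trans h1)

variable [T2Space X] [MeasurableSpace X] [BorelSpace X]

theorem integral_α {μ : Measure X} {g : G} (hμ : μ.map (S.act g) = μ) (f : C(X, ℂ)) :
    ∫ x, S.α g f x ∂μ = ∫ x, f x ∂μ := by
  conv_lhs => rw [← hμ]
  rw [integral_map (S.act g).continuous.aemeasurable (S.α g f).continuous.aestronglyMeasurable]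
  exact integral_congr_ae (.of_forall fun x => S.α_apply_actFun g f x)

theorem isTracialState_integral_expect {μ : Measure X} (hμ : μ ∈ S.invariantMeasures) :
    IsTracialState fun b : S.Cr => ∫ x, S.expect b x ∂μ := by
  obtain ⟨hp, -, hinv⟩ := hμ
  have hlin : IsLinearMap ℂ fun b : S.Cr => ∫ x, S.expect b x ∂μ :=
    ⟨fun x y => integral_add (integrable_continuousMap μ (S.expect x))
      (integrable_continuousMap μ (S.expect y)),
     fun c x => integral_const_mul c (S.expect x)⟩
  have hbound : ∀ b : S.Cr, ‖∫ x, S.expect b x ∂μ‖ ≤ 1 * ‖b‖ := fun b => by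
    refine (norm_integral_le_of_norm_le_const (.of_forall fun x =>
      ((S.expect b).norm_coe_le_norm x).trans (S.norm_expect_le b))).trans ?_
    simp
  have hcont : Continuous fun b : S.Cr => ∫ x, S.expect b x ∂μ :=
    (hlin.mk'.mkContinuous 1 hbound).continuous
  refine ⟨hlin, fun b => ?_, ?_, fun x y => ?_⟩
  · simp only [expect_star_mul_self_apply]
    rw [integral_complex_ofReal]
    exact Complex.zero_le_real.2 (integral_nonneg fun x => by positivity)
  · beta_reduce
    rw [← inc_one, expect_inc]
    simp
  · induction y using S.Cr_induction with
    | hc => exact isClosed_eq (hcont.comp (by fun_prop)) (hcont.comp (by fun_prop))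
    | h0 => simp
    | hadd y z hy hz =>
      rw [mul_add, add_mul]
      exact (hlin.map_add _ _).trans ((congrArg₂ (· + ·) hy hz).trans (hlin.map_add _ _).symm)
    | hm a g =>
      -- Conjugating `x a λ(g)` by `λ(g)` gives `λ(g) x a` and leaves the integral of the
      -- expectation unchanged by invariance. Commutativity of `C(X)` then moves `a` to the front
      -- inside `E`.
      have h1 : S.lam g * (x * (S.inc a * S.lam g)) * star (S.lam g) =
          S.lam g * x * S.inc a := by
        simp only [mul_assoc, lam_mul_star_lam, mul_one]
      have h2 : S.expect (S.lam g * x * S.inc a) = S.expect (S.inc a * S.lam g * x) := by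
        rw [expect_mul_inc, mul_assoc, expect_inc_mul]
      beta_reduce
      rw [← h2, ← h1, expect_lam_conj, S.integral_α (hinv g)]

/-- Injectivity holds because `E` is the identity on `C(X)`. For surjectivity, the restriction of
`τ` to `C(X)` is a state, and `τ(λ(g) f λ(g)*) = τ(f)` makes its representing measure invariant. -/
theorem bijOn_tracialStates (hG : InClassP G) :
    Set.BijOn (fun (μ : Measure X) (b : S.Cr) => ∫ x, S.expect b x ∂μ) S.invariantMeasures
      {τ : S.Cr → ℂ | IsTracialState τ} := by
  refine ⟨fun μ hμ => S.isTracialState_integral_expect hμ, fun μ hμ ν hν h => ?_, fun τ hτ => ?_⟩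
  · have := hμ.2.1
    have := hν.2.1
    refine ext_of_integral_continuousMap fun f => ?_
    simpa only [expect_inc] using congrFun h (S.inc f)
  · have hτ : IsTracialState τ := hτ
    obtain ⟨μ, hp, hreg, hμ⟩ := exists_regular_measure_of_state
      (hτ.1.mk' ∘ₗ S.incHom.toAlgHom.toLinearMap)
      (fun f => by
        have h := hτ.2.1 (S.inc f)
        rw [← inc_star, ← inc_mul] at h
        exact h)
      (by
        have h := hτ.2.2.1
        rw [← inc_one] at h
        exact h)
    have hμ' : ∀ f : C(X, ℂ), ∫ x, f x ∂μ = τ (S.inc f) := fun f => (hμ f).symm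
    refine ⟨μ, ⟨hp, hreg, fun g => ?_⟩, ?_⟩
    · have : (μ.map (S.act g)).Regular := Measure.Regular.map (S.act g)
      refine ext_of_integral_continuousMap fun f => ?_
      rw [integral_map (S.act g).continuous.aemeasurable f.continuous.aestronglyMeasurable]
      have h1 : ∀ x, f (S.act g x) = S.α g⁻¹ f x := fun x => by
        rw [S.α_apply, act_inv_symm_apply]
      simp only [h1]
      rw [hμ', hμ', ← lam_mul_inc_mul_star, hτ.2.2.2, ← mul_assoc, star_lam_mul_lam, one_mul]
    · funext b
      rw [S.trace_eq_trace_expect hG hτ b]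
      exact hμ' _

end Traces

end TwistedAction

end TwistedCrossed

namespace TwistedCrossed

/-! ### General facts on `*`-homomorphisms and simple quotients. -/

section CStarHoms

variable {A B : Type*} [CStarAlgebra A] [CStarAlgebra B]

theorem continuous_starAlgHom (φ : A →⋆ₐ[ℂ] B) : Continuous φ :=
  AddMonoidHomClass.continuous_of_bound φ 1 fun a => by
    simpa using NonUnitalStarAlgHom.norm_apply_le φ a

/-- Truncate `a` at `±‖φ(a)‖` by functional calculus. The truncation is the identity on the spectrum
of `φ(a)`, so the image does not change. -/
theorem exists_lift_norm_le_of_isSelfAdjoint [Nontrivial B] (φ : A →⋆ₐ[ℂ] B) {a : A}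
    (ha : IsSelfAdjoint a) : ∃ a', φ a' = φ a ∧ ‖a'‖ ≤ ‖φ a‖ := by
  let f : ℝ → ℝ := fun t => max (-‖φ a‖) (min ‖φ a‖ t)
  have hf : Continuous f := by fun_prop
  have hφ : Continuous φ := continuous_starAlgHom φ
  refine ⟨cfc f a, ?_, norm_cfc_le (norm_nonneg _) fun t _ => ?_⟩
  · have hφa : IsSelfAdjoint (φ a) := ha.map φ
    rw [StarAlgHomClass.map_cfc (S := ℂ) φ f a hf.continuousOn hφ ha hφa]
    conv_rhs => rw [← cfc_id ℝ (φ a)]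
    refine cfc_congr fun t ht => ?_
    have h1 := abs_le.1 ((Real.norm_eq_abs t).symm.trans_le (spectrum.norm_le_norm_of_mem ht))
    change max _ (min _ _) = t
    rw [min_eq_right h1.2, max_eq_right h1.1]
  · rw [Real.norm_eq_abs, abs_le]
    exact ⟨le_max_left _ _, max_le (by linarith [norm_nonneg (φ a)]) (min_le_left _ _)⟩

theorem exists_lift_norm_le [Nontrivial B] (φ : A →⋆ₐ[ℂ] B) (a : A) :
    ∃ a', φ a' = φ a ∧ ‖a'‖ ≤ 2 * ‖φ a‖ := by
  obtain ⟨u, hu, hu'⟩ := exists_lift_norm_le_of_isSelfAdjoint φ (realPart a).2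
  obtain ⟨v, hv, hv'⟩ := exists_lift_norm_le_of_isSelfAdjoint φ (imaginaryPart a).2
  have hre : φ (realPart a : A) = (realPart (φ a) : B) := by
    simp only [realPart_apply_coe, map_real_smul φ (continuous_starAlgHom φ), map_add, map_star]
  have him : φ (imaginaryPart a : A) = (imaginaryPart (φ a) : B) := by
    simp only [imaginaryPart_apply_coe, map_real_smul φ (continuous_starAlgHom φ), map_smul,
      map_sub, map_star]
  refine ⟨u + Complex.I • v, ?_, ?_⟩
  · rw [map_add, map_smul, hu, hv, ← map_smul, ← map_add, realPart_add_I_smul_imaginaryPart]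
  · rw [hre] at hu'
    rw [him] at hv'
    have h1 : ‖(realPart (φ a) : B)‖ ≤ ‖φ a‖ := realPart.norm_le (φ a)
    have h2 : ‖(imaginaryPart (φ a) : B)‖ ≤ ‖φ a‖ := imaginaryPart.norm_le (φ a)
    calc ‖u + Complex.I • v‖ ≤ ‖u‖ + ‖Complex.I • v‖ := norm_add_le _ _
      _ = ‖u‖ + ‖v‖ := by rw [norm_smul, Complex.norm_I, one_mul]
      _ ≤ 2 * ‖φ a‖ := by linarith

/-- A `*`-homomorphism of C⋆-algebras with dense range is surjective. -/
theorem surjective_of_denseRange (φ : A →⋆ₐ[ℂ] B) (h : DenseRange φ) : Function.Surjective φ := by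
  rcases subsingleton_or_nontrivial B with hB | hB
  · exact fun b => ⟨0, Subsingleton.elim _ _⟩
  let f : NormedAddGroupHom A B :=
    (φ : A →+ B).mkNormedAddGroupHom 1 fun a => by
      simpa using NonUnitalStarAlgHom.norm_apply_le φ a
  have h1 : f.SurjectiveOnWith (φ : A →+ B).range 2 := by
    rintro _ ⟨a, rfl⟩
    exact exists_lift_norm_le φ a
  -- Lifts of controlled norm and completeness of `A` allow a limit of the range to be lifted by
  -- successive approximation.
  have h2 := controlled_closure_of_complete (by norm_num) one_pos h1
  intro b
  obtain ⟨a, ha, -⟩ := h2 b (h b)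
  exact ⟨a, ha⟩

theorem range_subset_range_of_single {ι M : Type*} [AddCommMonoid M] [Module ℂ M]
    (φ : A →⋆ₐ[ℂ] B) (f : (ι →₀ M) →ₗ[ℂ] B) (h : ∀ i m, ∃ a, φ a = f (Finsupp.single i m)) :
    Set.range f ⊆ Set.range φ := by
  rintro _ ⟨c, rfl⟩
  induction c using Finsupp.induction_linear with
  | zero => exact ⟨0, by rw [map_zero, map_zero]⟩
  | add c d hc hd =>
    obtain ⟨x, hx⟩ := hc
    obtain ⟨y, hy⟩ := hd
    exact ⟨x + y, by rw [map_add, map_add, hx, hy]⟩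
  | single i m => exact h i m

/-- As `K` contains `ker q`, it is the full preimage of `q(K)`. By the open mapping theorem `q` is a
quotient map, so `q(K)` is a closed ideal of a simple algebra; it is not everything, since `1 ∉ K`.
-/
theorem mem_ker_of_isSimple (q : A →⋆ₐ[ℂ] B) (hq : Function.Surjective q) (hB : IsSimple B)
    {K : TwoSidedIdeal A} (hK : IsClosed (K : Set A)) (hle : ∀ a, q a = 0 → a ∈ K)
    (h1 : (1 : A) ∉ K) {a : A} (ha : a ∈ K) : q a = 0 := by
  let I : TwoSidedIdeal B := .mk' (q '' (K : Set A)) ⟨0, zero_mem K, map_zero q⟩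
    (by
      rintro _ _ ⟨x, hx, rfl⟩ ⟨y, hy, rfl⟩
      exact ⟨x + y, add_mem hx hy, map_add q x y⟩)
    (by
      rintro _ ⟨x, hx, rfl⟩
      exact ⟨-x, neg_mem hx, map_neg q x⟩)
    (by
      rintro z _ ⟨y, hy, rfl⟩
      obtain ⟨z, rfl⟩ := hq z
      exact ⟨z * y, K.mul_mem_left z y hy, map_mul q z y⟩)
    (by
      rintro _ z ⟨y, hy, rfl⟩
      obtain ⟨z, rfl⟩ := hq z
      exact ⟨y * z, K.mul_mem_right y z hy, map_mul q y z⟩)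
  have hIcoe : (I : Set B) = q '' (K : Set A) := TwoSidedIdeal.coe_mk' ..
  have hsat : ∀ x, q x ∈ q '' (K : Set A) → x ∈ K := by
    rintro x ⟨y, hy, hxy⟩
    have := add_mem (hle (x - y) (by rw [map_sub, hxy, sub_self])) hy
    rwa [sub_add_cancel] at this
  have hclosed : IsClosed (I : Set B) := by
    rw [hIcoe]
    have hqm : Topology.IsQuotientMap q :=
      ContinuousLinearMap.isQuotientMap
        (⟨q.toAlgHom.toLinearMap, continuous_starAlgHom q⟩ : A →L[ℂ] B) hq
    rw [← hqm.isClosed_preimage]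
    convert hK
    exact Set.Subset.antisymm hsat (Set.subset_preimage_image _ _)
  rcases hB.2 I hclosed with h | h
  · have : q a ∈ (I : Set B) := hIcoe ▸ ⟨a, ha, rfl⟩
    rwa [h] at this
  · have : (1 : B) ∈ (I : Set B) := by rw [h]; trivial
    rw [hIcoe, ← map_one q] at this
    exact (h1 (hsat 1 this)).elim

/-- Two surjective `*`-homomorphisms with the same kernel have isomorphic ranges. -/
theorem exists_starAlgEquiv_of_ker_eq {C : Type*} [Ring C] [StarRing C] [Algebra ℂ C]
    [StarModule ℂ C] (q : A →⋆ₐ[ℂ] B) (hq : Function.Surjective q) (p : A →⋆ₐ[ℂ] C)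
    (hp : Function.Surjective p) (h : ∀ a, q a = 0 ↔ p a = 0) :
    ∃ ψ : B ≃⋆ₐ[ℂ] C, ∀ a, ψ (q a) = p a := by
  have key : ∀ a b, q a = q b ↔ p a = p b := fun a b => by
    rw [← sub_eq_zero, ← map_sub, h, map_sub, sub_eq_zero]
  -- A set-theoretic section suffices: equality of the kernels makes `p ∘ s` independent of the
  -- choice of lifts.
  let s := Function.surjInv hq
  have hs : ∀ b, q (s b) = b := Function.surjInv_eq hq
  have hps : ∀ a, p (s (q a)) = p a := fun a => (key _ _).1 (hs _)
  let ψ : B →⋆ₐ[ℂ] C :=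
    { toFun := fun b => p (s b)
      map_one' := by rw [← map_one q, hps, map_one]
      map_mul' := fun x y => by
        rw [← map_mul, ← key, hs, map_mul, hs, hs]
      map_zero' := by rw [← map_zero q, hps, map_zero]
      map_add' := fun x y => by
        rw [← map_add, ← key, hs, map_add, hs, hs]
      commutes' := fun r => by
        rw [← AlgHomClass.commutes q r, hps, AlgHomClass.commutes]
      map_star' := fun x => by
        rw [← map_star, ← key, hs, map_star, hs] }
  have hψ : ∀ a, ψ (q a) = p a := hps
  refine ⟨StarAlgEquiv.ofBijective ψ ⟨fun x y hxy => ?_, fun c => ?_⟩, hψ⟩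
  · rw [← hs x, ← hs y]
    exact (key _ _).2 hxy
  · obtain ⟨a, rfl⟩ := hp c
    exact ⟨q a, hψ a⟩

end CStarHoms

namespace TwistedAction

/-! ### Proper ideals, minimal sets and simple quotients. -/

section Ideals

variable {G : Type*} [Group G] {X : Type*} [TopologicalSpace X] [CompactSpace X]
  (S : TwistedAction G C(X, ℂ))

theorem smul_mem_twoSidedIdeal {J : TwoSidedIdeal S.Cr} (c : ℂ) {x : S.Cr} (hx : x ∈ J) :
    c • x ∈ J := by
  rw [← one_mul x, ← smul_mul_assoc]
  exact J.mul_mem_left _ _ hx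

theorem IsAveraging.apply_mem {S : TwistedAction G C(X, ℂ)} {M : Set G}
    {φ : S.Cr →ₗ[ℂ] S.Cr} (h : S.IsAveraging M φ) {J : TwoSidedIdeal S.Cr} {x : S.Cr}
    (hx : x ∈ J) : φ x ∈ J :=
  h.map_mem (C := (J : Set S.Cr))
    (fun _ _ hy => J.mul_mem_right _ _ (J.mul_mem_left _ _ hy))
    (fun _ _ hy => S.smul_mem_twoSidedIdeal _ (sum_mem fun j _ => hy j)) hx

/-- The inverse of `f` has norm at most `δ⁻¹`, so `f⁻¹ y` is at distance less than `1` from `1` and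
is an invertible element of `J`. -/
theorem one_mem_of_norm_sub_inc_lt {J : TwoSidedIdeal S.Cr} {y : S.Cr} (hy : y ∈ J)
    {f : C(X, ℂ)} {δ : ℝ} (hδ : 0 < δ) (hf : ∀ x, δ ≤ (f x).re) (h : ‖y - S.inc f‖ < δ) :
    (1 : S.Cr) ∈ J := by
  have hf0 : ∀ x, f x ≠ 0 := fun x h0 => by
    have := hf x
    rw [h0, Complex.zero_re] at this
    linarith
  let k : C(X, ℂ) := ⟨fun x => (f x)⁻¹, f.continuous.inv₀ hf0⟩
  have hk : k * f = 1 := by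
    ext x
    exact inv_mul_cancel₀ (hf0 x)
  have hkn : ‖k‖ ≤ δ⁻¹ := (ContinuousMap.norm_le _ (by positivity)).2 fun x => by
    change ‖(f x)⁻¹‖ ≤ _
    rw [norm_inv]
    gcongr
    exact (hf x).trans (Complex.re_le_norm _)
  have h1 : ‖S.inc k * (S.inc f - y)‖ < 1 :=
    calc _ ≤ ‖S.inc k‖ * ‖S.inc f - y‖ := norm_mul_le _ _
      _ ≤ δ⁻¹ * ‖y - S.inc f‖ := by
        rw [norm_sub_rev]
        gcongr
        exact (S.norm_inc_le k).trans hkn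
      _ < δ⁻¹ * δ := by gcongr
      _ = 1 := inv_mul_cancel₀ hδ.ne'
  have h2 := isUnit_one_sub_of_norm_lt_one h1
  rw [mul_sub, ← inc_mul, hk, inc_one, sub_sub_cancel] at h2
  obtain ⟨z, hz⟩ := h2.exists_left_inv
  rw [← hz]
  exact J.mul_mem_left _ _ (J.mul_mem_left _ _ hy)

variable [T2Space X]

/-- Average `y - E(y)` below `δ`. The same averaging keeps `y` in `J` and keeps `E(y)` among the
functions with real part at least `δ`, a set stable under the action and under means. -/
theorem one_mem_of_expect_re_pos (hG : InClassP G) {J : TwoSidedIdeal S.Cr} {y : S.Cr}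
    (hy : y ∈ J) {δ : ℝ} (hδ : 0 < δ) (hf : ∀ x, δ ≤ (S.expect y x).re) : (1 : S.Cr) ∈ J := by
  obtain ⟨M, φ, hφ, hlt⟩ := S.exists_averaging_lt hG
    (x := y - S.inc (S.expect y)) (by rw [expect_sub, expect_inc, sub_self]) hδ
  have h1 : φ (S.inc (S.expect y)) ∈ {z | ∃ f : C(X, ℂ), (∀ x, δ ≤ (f x).re) ∧ z = S.inc f} := by
    refine hφ.map_mem ?_ ?_ ⟨_, hf, rfl⟩
    · rintro g _ ⟨f, hf, rfl⟩
      refine ⟨S.α g f, fun x => ?_, S.lam_mul_inc_mul_star g f⟩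
      rw [S.α_apply]
      exact hf _
    · intro N x hx
      choose f hf hfx using hx
      refine ⟨((N + 1 : ℂ)⁻¹) • ∑ j, f j, fun x => ?_, ?_⟩
      · have h3 : ((N + 1 : ℂ)⁻¹) = (((N + 1 : ℝ)⁻¹ : ℝ) : ℂ) := by push_cast; rfl
        rw [ContinuousMap.smul_apply, ContinuousMap.sum_apply, smul_eq_mul, h3,
          Complex.re_ofReal_mul, Complex.re_sum, ← div_eq_inv_mul, le_div_iff₀ (by positivity)]
        calc δ * (N + 1) = ∑ _j : Fin (N + 1), δ := by simp [mul_comm]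
          _ ≤ _ := Finset.sum_le_sum fun j _ => hf j x
      · simp only [hfx]
        rw [inc_smul, ← incHom_apply, map_sum]
        rfl
  obtain ⟨f, hf, hφf⟩ := h1
  rw [map_sub, hφf] at hlt
  exact S.one_mem_of_norm_sub_inc_lt (hφ.apply_mem hy) hδ hf hlt

/-- Replacing `y` by `y* y` makes the expectation non-negative everywhere and still positive at the
given point; compactness then yields a finite sum that is positive on all of `X`. -/
theorem exists_mem_expect_re_pos {J : TwoSidedIdeal S.Cr}
    (h : ∀ x, ∃ y ∈ J, S.expect y x ≠ 0) : ∃ y ∈ J, ∃ δ > 0, ∀ x, δ ≤ (S.expect y x).re := by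
  choose y hyJ hy using h
  have hnn : ∀ (z : S.Cr) x, 0 ≤ (S.expect (star z * z) x).re := fun z x => by
    rw [expect_star_mul_self_apply, Complex.ofReal_re]
    positivity
  have hpos : ∀ x, 0 < (S.expect (star (y x) * y x) x).re := fun x => by
    rw [expect_star_mul_self_apply, Complex.ofReal_re]
    have := (norm_pos_iff.2 (hy x)).trans_le (S.norm_expect_apply_le (y x) x)
    positivity
  have hc : ∀ z : S.Cr, Continuous fun x => (S.expect z x).re := fun z =>
    Complex.continuous_re.comp (S.expect z).continuous
  obtain ⟨t, ht⟩ := isCompact_univ.elim_finite_subcover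
    (fun i => {x | 0 < (S.expect (star (y i) * y i) x).re})
    (fun i => isOpen_lt continuous_const (hc _))
    (fun x _ => Set.mem_iUnion.2 ⟨x, hpos x⟩)
  have hsum : ∀ x, S.expect (∑ i ∈ t, star (y i) * y i) x =
      ∑ i ∈ t, S.expect (star (y i) * y i) x := fun x => by
    have := map_sum (⟨⟨S.expect, S.expect_add⟩, S.expect_smul⟩ : S.Cr →ₗ[ℂ] C(X, ℂ))
      (fun i => star (y i) * y i) t
    exact (congrArg (fun k : C(X, ℂ) => k x) this).trans (ContinuousMap.sum_apply _ _ _)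
  have hsumpos : ∀ x, 0 < (S.expect (∑ i ∈ t, star (y i) * y i) x).re := fun x => by
    rw [hsum, Complex.re_sum]
    obtain ⟨i, hi, hx⟩ := Set.mem_iUnion₂.1 (ht (Set.mem_univ x))
    exact Finset.sum_pos' (fun i _ => hnn _ _) ⟨i, hi, hx⟩
  refine ⟨∑ i ∈ t, star (y i) * y i, sum_mem fun i _ => J.mul_mem_left _ _ (hyJ i), ?_⟩
  rcases isEmpty_or_nonempty X with hX | hX
  · exact ⟨1, one_pos, fun x => hX.elim x⟩
  · obtain ⟨x₀, -, h₀⟩ := isCompact_univ.exists_isMinOn Set.univ_nonempty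
      (hc (∑ i ∈ t, star (y i) * y i)).continuousOn
    exact ⟨_, hsumpos x₀, fun x => h₀ (Set.mem_univ x)⟩

theorem ClosedInvariant.ext_carrier {S : TwistedAction G C(X, ℂ)} {Y Z : S.ClosedInvariant}
    (h : Y.carrier = Z.carrier) : Y = Z := by
  cases Y
  cases Z
  cases h
  rfl

theorem exists_minimal_subset (Z : S.ClosedInvariant) (hZ : Z.carrier.Nonempty) :
    ∃ Y ∈ S.minimalSets, Y.carrier ⊆ Z.carrier := by
  obtain ⟨m, hm, hmin⟩ := zorn_superset_nonempty
    {s : Set X | IsClosed s ∧ (∀ g, ∀ x ∈ s, S.act g x ∈ s) ∧ s.Nonempty}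
    (fun c hc hchain hne => by
      refine ⟨⋂₀ c, ⟨isClosed_sInter fun s hs => (hc hs).1, fun g x hx s hs =>
        (hc hs).2.1 g x (hx s hs), ?_⟩, fun s hs => Set.sInter_subset_of_mem hs⟩
      have := hne.to_subtype
      exact IsCompact.nonempty_sInter_of_directed_nonempty_isCompact_isClosed
        (fun s hs t ht => (hchain.total hs ht).elim (fun h => ⟨s, hs, subset_rfl, h⟩)
          fun h => ⟨t, ht, h, subset_rfl⟩) (fun s hs => (hc hs).2.2) (fun s hs => (hc hs).1.isCompact)
        (fun s hs => (hc hs).1))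
    Z.carrier ⟨Z.isClosed, Z.invariant, hZ⟩
  refine ⟨⟨m, hmin.1.1, hmin.1.2.1⟩, ⟨hmin.1.2.2, fun W hW hWm => ?_⟩, hm⟩
  exact hWm.antisymm (hmin.2 ⟨W.isClosed, W.invariant, hW⟩ hWm)

/-- The common zero set of the expectations of the elements of an ideal. -/
def expectZeros (J : TwoSidedIdeal S.Cr) : S.ClosedInvariant where
  carrier := {x | ∀ y ∈ J, S.expect y x = 0}
  isClosed := by
    have : {x | ∀ y ∈ J, S.expect y x = 0} = ⋂ y ∈ J, {x | S.expect y x = 0} := by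
      ext x
      simp only [Set.mem_ofPred_eq, Set.mem_iInter]
    rw [this]
    exact isClosed_biInter fun y _ => isClosed_eq (S.expect y).continuous continuous_const
  invariant g x hx y hy := by
    have h1 := hx (S.lam g⁻¹ * y * star (S.lam g⁻¹))
      (J.mul_mem_right _ _ (J.mul_mem_left _ _ hy))
    rwa [expect_lam_conj, α_apply, act_inv_symm_apply] at h1

/-- Every proper ideal is annihilated by the canonical homomorphism of some minimal set. -/
theorem exists_minimal_toQuotient_eq_zero (hG : InClassP G) (J : TwoSidedIdeal S.Cr)
    (hJ : (1 : S.Cr) ∉ J) : ∃ Y ∈ S.minimalSets, ∀ b ∈ J, Y.toQuotient b = 0 := by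
  have hne : (S.expectZeros J).carrier.Nonempty := by
    by_contra hempty
    rw [Set.not_nonempty_iff_eq_empty, Set.eq_empty_iff_forall_notMem] at hempty
    obtain ⟨y, hy, δ, hδ, hyδ⟩ := S.exists_mem_expect_re_pos (J := J) fun x => by
      by_contra! h
      exact hempty x h
    exact hJ (S.one_mem_of_expect_re_pos hG hy hδ hyδ)
  obtain ⟨Y, hY, hYZ⟩ := S.exists_minimal_subset _ hne
  -- Faithfulness of the expectation over `Y` reduces the claim to `E(b* b)|_Y = 0`, which holds
  -- because `b* b ∈ J` and `Y` lies in the zero set.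
  refine ⟨Y, hY, fun b hb => Y.restrict.eq_zero_of_expect_star_mul_self ?_⟩
  rw [← map_star, ← map_mul, expect_toQuotient]
  ext y
  exact hYZ y.2 _ (J.mul_mem_left _ _ hb)

namespace ClosedInvariant

variable {S} (Y : S.ClosedInvariant)

theorem res_surjective : Function.Surjective Y.res := fun f => by
  obtain ⟨k, hk⟩ := ContinuousMap.exists_restrict_eq Y.isClosed f
  exact ⟨k, hk⟩

theorem toQuotient_inc_mul_lam (a : C(X, ℂ)) (g : G) :
    Y.toQuotient (S.inc a * S.lam g) = Y.restrict.inc (Y.res a) * Y.restrict.lam g := by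
  rw [map_mul, Y.toQuotient_inc, Y.toQuotient_lam]

theorem toQuotient_surjective : Function.Surjective Y.toQuotient := by
  refine surjective_of_denseRange _ (Y.restrict.denseRange_finSum.mono ?_)
  refine range_subset_range_of_single Y.toQuotient Y.restrict.finSum fun g a => ?_
  obtain ⟨a, rfl⟩ := Y.res_surjective a
  exact ⟨S.inc a * S.lam g,
    (Y.toQuotient_inc_mul_lam a g).trans (Y.restrict.finSum_single g (Y.res a)).symm⟩

theorem toQuotient_one_ne_zero (hY : Y.carrier.Nonempty) : Y.toQuotient 1 ≠ 0 := by
  obtain ⟨x, hx⟩ := hY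
  intro h
  have h1 := Y.restrict.expect_inc 1
  rw [inc_one, ← map_one Y.toQuotient, h, expect_zero] at h1
  have h2 := congrArg (fun k : C(Y.carrier, ℂ) => k ⟨x, hx⟩) h1
  exact zero_ne_one h2

/-- A function vanishing on `Y` but not at a point of `Z ∖ Y` would lie in the first kernel and not
in the second. -/
theorem carrier_subset_of_ker_le {Z : S.ClosedInvariant}
    (h : ∀ b, Y.toQuotient b = 0 → Z.toQuotient b = 0) : Z.carrier ⊆ Y.carrier := by
  intro x hx
  by_contra hxY
  have h1 : x ∈ ContinuousMap.setOfIdeal (ContinuousMap.idealOfSet ℂ Y.carrierᶜ) := by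
    rwa [ContinuousMap.setOfIdeal_ofSet_of_isOpen ℂ Y.isClosed.isOpen_compl]
  obtain ⟨f, hf, hfx⟩ := ContinuousMap.mem_setOfIdeal.1 h1
  rw [ContinuousMap.mem_idealOfSet, compl_compl] at hf
  have hY : Y.res f = 0 := by
    ext y
    exact hf y.2
  have h2 := h (S.inc f) (by rw [toQuotient_inc, hY, ← incHom_apply, map_zero])
  rw [toQuotient_inc, ← incHom_apply, map_eq_zero_iff _ Z.restrict.inc_injective] at h2
  exact hfx (congrArg (fun k : C(Z.carrier, ℂ) => k ⟨x, hx⟩) h2)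

theorem eq_of_ker_le {Z : S.ClosedInvariant} (hY : Y ∈ S.minimalSets) (hZ : Z ∈ S.minimalSets)
    (h : ∀ b, Y.toQuotient b = 0 → Z.toQuotient b = 0) : Z = Y :=
  ext_carrier (hY.2 Z hZ.1 (Y.carrier_subset_of_ker_le h))

/-- The kernel of the canonical homomorphism. -/
def kernel : TwoSidedIdeal S.Cr := TwoSidedIdeal.ker Y.toQuotient

theorem mem_kernel {b : S.Cr} : b ∈ Y.kernel ↔ Y.toQuotient b = 0 := TwoSidedIdeal.mem_ker _

theorem continuous_toQuotient : Continuous Y.toQuotient := continuous_starAlgHom Y.toQuotient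

theorem isClosed_kernel : IsClosed (Y.kernel : Set S.Cr) := by
  have : (Y.kernel : Set S.Cr) = Y.toQuotient ⁻¹' {0} := by
    ext b
    exact Y.mem_kernel
  rw [this]
  exact isClosed_singleton.preimage Y.continuous_toQuotient

/-- A proper ideal above `ker κ_Y` lies in `ker κ_Z` for some minimal `Z`, and then `Z = Y`. -/
theorem kernel_mem_maximalIdeals (hG : InClassP G) (hY : Y ∈ S.minimalSets) :
    Y.kernel ∈ maximalIdeals S.Cr := by
  refine ⟨⟨Y.isClosed_kernel, fun h => Y.toQuotient_one_ne_zero hY.1 ?_⟩, fun J hJ hle => ?_⟩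
  · rw [← mem_kernel, TwoSidedIdeal.one_mem_iff, h]
  · obtain ⟨Z, hZ, hJZ⟩ := S.exists_minimal_toQuotient_eq_zero hG J
      (fun h => hJ.2 ((TwoSidedIdeal.one_mem_iff J).1 h))
    obtain rfl := Y.eq_of_ker_le hY hZ fun b hb => hJZ b (hle (Y.mem_kernel.2 hb))
    exact fun b hb => Z.mem_kernel.2 (hJZ b hb)

theorem isSimple_restrict (hG : InClassP G) (hY : Y ∈ S.minimalSets) : IsSimple Y.restrict.Cr := by
  refine ⟨⟨⟨_, _, Y.toQuotient_one_ne_zero hY.1⟩⟩, fun I hI => or_iff_not_imp_right.2 fun htop => ?_⟩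
  -- The preimage of `I` is a proper ideal containing `ker κ_Y`, so the minimal set found for it
  -- must be `Y`.
  obtain ⟨Z, hZ, hIZ⟩ := S.exists_minimal_toQuotient_eq_zero hG (I.comap Y.toQuotient) (by
    rwa [TwoSidedIdeal.mem_comap, map_one, TwoSidedIdeal.one_mem_iff])
  obtain rfl := Y.eq_of_ker_le hY hZ fun b hb => hIZ b (by
    rw [TwoSidedIdeal.mem_comap, hb]
    exact zero_mem I)
  rw [eq_bot_iff]
  intro x hx
  obtain ⟨b, rfl⟩ := Z.toQuotient_surjective x
  rw [hIZ b (TwoSidedIdeal.mem_comap _ |>.2 hx)]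
  exact zero_mem _

end ClosedInvariant

theorem IsExact.inducedIdeal_eq {S : TwistedAction G C(X, ℂ)} (hS : S.IsExact)
    (Y : S.ClosedInvariant) : Y.inducedIdeal = Y.kernel := by
  ext b
  rw [← hS Y b, Y.mem_kernel]

theorem IsExact.bijOn_maximalIdeals {S : TwistedAction G C(X, ℂ)} (hS : S.IsExact)
    (hG : InClassP G) :
    Set.BijOn (fun Y : S.ClosedInvariant => Y.inducedIdeal) S.minimalSets
      (maximalIdeals S.Cr) := by
  simp only [hS.inducedIdeal_eq]
  refine ⟨fun Y hY => Y.kernel_mem_maximalIdeals hG hY, fun Y hY Z hZ h => ?_, fun J hJ => ?_⟩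
  · refine (Y.eq_of_ker_le hY hZ fun b hb => ?_).symm
    rw [← Y.mem_kernel, show Y.kernel = Z.kernel from h] at hb
    exact Z.mem_kernel.1 hb
  · obtain ⟨Y, hY, hJY⟩ := S.exists_minimal_toQuotient_eq_zero hG J
      (fun h => hJ.1.2 ((TwoSidedIdeal.one_mem_iff J).1 h))
    have hle : J ≤ Y.kernel := fun b hb => Y.mem_kernel.2 (hJY b hb)
    exact ⟨Y, hY, le_antisymm (hJ.2 (Y.kernel_mem_maximalIdeals hG hY).1 hle) hle⟩

theorem exists_starAlgEquiv_of_isSimple (hG : InClassP G) {D : Type*} [CStarAlgebra D]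
    (q : S.Cr →⋆ₐ[ℂ] D) (hq : Function.Surjective q) (hD : IsSimple D) :
    ∃ Y ∈ S.minimalSets, ∃ ψ : D ≃⋆ₐ[ℂ] Y.restrict.Cr, ∀ b, ψ (q b) = Y.toQuotient b := by
  have := hD.1
  obtain ⟨Y, hY, hqY⟩ := S.exists_minimal_toQuotient_eq_zero hG (TwoSidedIdeal.ker q)
    (by rw [TwoSidedIdeal.mem_ker, map_one]; exact one_ne_zero)
  refine ⟨Y, hY, exists_starAlgEquiv_of_ker_eq q hq Y.toQuotient Y.toQuotient_surjective
    fun b => ⟨fun hb => hqY b ((TwoSidedIdeal.mem_ker q).2 hb), fun hb => ?_⟩⟩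
  -- So far `ker q ⊆ ker κ_Y`; simplicity of `D` gives the reverse inclusion.
  refine mem_ker_of_isSimple q hq hD Y.isClosed_kernel
    (fun a ha => Y.mem_kernel.2 (hqY a ((TwoSidedIdeal.mem_ker q).2 ha))) ?_ (Y.mem_kernel.2 hb)
  exact fun h => Y.toQuotient_one_ne_zero hY.1 (Y.mem_kernel.1 h)

end Ideals

end TwistedAction

end TwistedCrossed

end

theorem corollary3p12 {G : Type u} [Group G] (hG : TwistedCrossed.InClassP G)
    {X : Type v} [TopologicalSpace X] [CompactSpace X] [T2Space X]
    [MeasurableSpace X] [BorelSpace X]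
    (S : TwistedCrossed.TwistedAction G C(X, ℂ)) :
    Set.BijOn
      (fun (μ : MeasureTheory.Measure X) (b : S.Cr) => ∫ x, S.expect b x ∂μ)
      S.invariantMeasures
      {τ : S.Cr → ℂ | TwistedCrossed.IsTracialState τ} ∧
    (S.IsExact →
      Set.BijOn (fun Y : S.ClosedInvariant => Y.inducedIdeal) S.minimalSets
        (TwistedCrossed.maximalIdeals S.Cr) ∧
      (∀ Y ∈ S.minimalSets,
        TwistedCrossed.IsSimple Y.restrict.Cr ∧
        Function.Surjective Y.toQuotient ∧
        ∀ b : S.Cr, Y.toQuotient b = 0 ↔ b ∈ Y.inducedIdeal) ∧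
      (∀ (D : Type w) [CStarAlgebra D] (q : S.Cr →⋆ₐ[ℂ] D),
        Function.Surjective q → TwistedCrossed.IsSimple D →
        ∃ Y ∈ S.minimalSets, ∃ ψ : D ≃⋆ₐ[ℂ] Y.restrict.Cr, ∀ b, ψ (q b) = Y.toQuotient b)) := by
  exact ⟨S.bijOn_tracialStates hG, fun hS => ⟨hS.bijOn_maximalIdeals hG,
    fun Y hY => ⟨Y.isSimple_restrict hG hY, Y.toQuotient_surjective, hS Y⟩,
    fun D _ q hq hD => S.exists_starAlgEquiv_of_isSimple hG q hq hD⟩⟩
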